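/- Call an integer $d$ a fundamental discriminant if either $d$ is square-free and $d\equiv 1 \pmod 4$, or $d=4m$ with $m$ square-free and $m\equiv 2,3\pmod 4$; it is even if $d>0$. For real $X>1$ let $X^\ast$ be the number of even fundamental discriminants $d\le X$. Put $$A_D(-r;r)=\prod_p\Big(1-\frac{1}{(p+1)p^{1-2r}}-\frac1{p+1}\Big)\Big(1-\frac1p\Big)^{-1},$$ and for an even Schwartz function $g$ on $\mathbb R$, with $\widehat g(\xi)=\int_{-\infty}^\infty g(x)e^{-2\pi i x\xi}\,dx$, put $$R(g;X)=-\frac{2}{X^\ast\log X}\sum_{d\le X}\int_{-\infty}^{\infty} g(\tau)\,e^{-2\pi i\tau\frac{\log(d/\pi)}{\log X}}\,\frac{\Gamma\left(\frac14-\frac{\pi i\tau}{\log X}\right)}{\Gamma\left(\frac14+\frac{\pi i\tau}{\log X}\right)}\,\zeta\Big(1-\frac{4\pi i\tau}{\log X}\Big)A_D\Big(-\frac{2\pi i\tau}{\log X};\frac{2\pi i\tau}{\log X}\Big)\,d\tau,$$ where $d$ runs over the even fundamental discriminants at most $X$ and, because of the pole of $\zeta$, the integral is a Cauchy principal value at $\tau=0$.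 Assume the Riemann Hypothesis, and let $\sigma>0$ be such that $\mathrm{supp}(\widehat g)\subset(-\sigma,\sigma)$. Then the principal values in $R(g;X)$ exist for all $X>1$, and for every $\epsilon>0$, as $X\to\infty$, $$R(g;X)=-\frac{g(0)}2+O\big(X^{-\frac34(1-\sigma)+\epsilon}\big),$$ with an implied constant depending only on $g,\sigma,\epsilon$. In particular, if $\sigma<1/3$, then $R(g;X)=-\frac{g(0)}2+O(X^{-\frac12+\epsilon})$ for every $\epsilon>0$. -/

import Mathlib

open Filter Topology MeasureTheory
open scoped SchwartzMap FourierTransform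

/-- `d` is a fundamental discriminant: either `d` is square-free and `d ≡ 1 mod 4`, or `d = 4 m`
with `m` square-free and `m ≡ 2, 3 mod 4`. -/
def IsFundamentalDiscr (d : ℤ) : Prop :=
  (Squarefree d ∧ d % 4 = 1) ∨
    ∃ m : ℤ, d = 4 * m ∧ Squarefree m ∧ (m % 4 = 2 ∨ m % 4 = 3)

open Classical in
/-- The even (that is, positive) fundamental discriminants that are at most `X`. -/
noncomputable def evenFundDiscr (X : ℝ) : Finset ℤ :=
  (Finset.Ioc 0 ⌊X⌋).filter IsFundamentalDiscr

/-- The arithmetic factor `A_D(-r; r)`, as an Euler product over all primes. -/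
noncomputable def arithFactor (r : ℂ) : ℂ :=
  ∏' p : Nat.Primes,
    (1 - 1 / (((p : ℂ) + 1) * (p : ℂ) ^ (1 - 2 * r)) - 1 / ((p : ℂ) + 1)) * (1 - 1 / (p : ℂ))⁻¹

/-- The integral over the real line, taken as a principal value at `0`, exists and equals `I`:
`f` is integrable off every neighbourhood of `0`, and the integrals over `|τ| > δ` tend to `I`
as `δ → 0+`. -/
def HasPrincipalValue (f : ℝ → ℂ) (I : ℂ) : Prop :=
  (∀ δ : ℝ, 0 < δ → IntegrableOn f {τ : ℝ | δ < |τ|}) ∧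
    Tendsto (fun δ : ℝ => ∫ τ in {τ : ℝ | δ < |τ|}, f τ) (𝓝[>] 0) (𝓝 I)

/-- The principal value at `0` of the integral of `f` over the real line. -/
noncomputable def principalValue (f : ℝ → ℂ) : ℂ :=
  limUnder (𝓝[>] (0 : ℝ)) (fun δ : ℝ => ∫ τ in {τ : ℝ | δ < |τ|}, f τ)

/-- The integrand of `R(g; X)` belonging to the discriminant `d`. It has a simple pole at `τ = 0`
when `g 0 ≠ 0`. -/
noncomputable def ratiosIntegrand (g : 𝓢(ℝ, ℂ)) (X : ℝ) (d : ℤ) (τ : ℝ) : ℂ :=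
  g τ *
    Complex.exp (-2 * Real.pi * Complex.I * τ * (Real.log (d / Real.pi) / Real.log X : ℝ)) *
    (Complex.Gamma (1 / 4 - Real.pi * Complex.I * τ / Real.log X) /
      Complex.Gamma (1 / 4 + Real.pi * Complex.I * τ / Real.log X)) *
    riemannZeta (1 - 4 * Real.pi * Complex.I * τ / Real.log X) *
    arithFactor (2 * Real.pi * Complex.I * τ / Real.log X)

/-- The term `R(g; X)`; the integrals are principal values at `τ = 0`. -/
noncomputable def ratiosTerm (g : 𝓢(ℝ, ℂ)) (X : ℝ) : ℂ :=
  -(2 / (((evenFundDiscr X).card : ℂ) * (Real.log X : ℂ))) *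
    ∑ d ∈ evenFundDiscr X, principalValue (ratiosIntegrand g X d)

/-! The Euler product collapses to `A_D(-r; r) = ζ(2) / ζ(2 - 2r)` (`arithFactor_eq`). With `w =
2πiτ / log X` the integrand becomes `E(w) / w` on the imaginary axis (`ratiosIntegrand_eq`), where
`E = ratiosNumerator` contains `Γ(1/4 - w/2) ζ(1 - 2w) / ζ(2 - 2w)`. The pole of `Γ` at `w = 1/2` is
cancelled by the pole of `ζ(2 - 2w)` there, and RH keeps the zeros of `ζ(2 - 2w)` out of `Re w <
3/4`. Hence `E` is holomorphic for `0 ≤ Re w < 3/4`, and this is the source of the exponent `3/4`.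

Since the Fourier transform of `g` has compact support, `g` extends to an entire function that
decays faster than any power on vertical lines, at the cost of a factor `X ^ (σ Re w)`
(`exists_norm_fourierLaplace_le`). This beats polynomial growth of the other factors:
`exists_norm_zetaReg_le` above, `exists_le_norm_zetaReg` (RH and Borel–Carathéodory) below,
`exists_norm_Gamma_div_Gamma_le` for the Gamma quotient. The contour can therefore be moved to `Re w
= c` for any `0 < c < 3/4` (`hasPrincipalValue_of_strip`). The principal value picks up half a
residue, `-π E(0)` with `E(0) = -g(0)/2`, which after normalisation is exactly the main term.

The shifted integral for `d` is `O(X ^ (σ c) d ^ (-c))`. Summing over `d ≤ X` gives `X ^ (σ c + 1 -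
c)`, and dividing by `X* ≥ X / 32` leaves `X ^ (-c (1 - σ))` (`ratiosTerm_isBigO`). Letting `c`
approach `3/4` costs the `ε`. -/

/-! ### Polynomial growth of `(s - 1) ζ(s)`. -/

/-- The entire function `(s - 1) ζ(s)`. -/
noncomputable def zetaReg : ℂ → ℂ := Function.update (fun s => (s - 1) * riemannZeta s) 1 1

theorem zetaReg_one : zetaReg 1 = 1 := by simp [zetaReg]

theorem zetaReg_of_ne {s : ℂ} (hs : s ≠ 1) : zetaReg s = (s - 1) * riemannZeta s := by
  simp [zetaReg, hs]

theorem differentiable_zetaReg : Differentiable ℂ zetaReg := by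
  rw [← differentiableOn_univ]
  refine (Complex.differentiableOn_compl_singleton_and_continuousAt_iff (c := 1) univ_mem).1 ⟨?_, ?_⟩
  · intro s hs
    have hs1 : s ≠ 1 := by simpa using hs
    have h : DifferentiableAt ℂ (fun s => (s - 1) * riemannZeta s) s :=
      (differentiableAt_id.sub_const 1).mul (differentiableAt_riemannZeta hs1)
    refine (h.congr_of_eventuallyEq ?_).differentiableWithinAt
    filter_upwards [isOpen_ne.mem_nhds hs1] with z hz using zetaReg_of_ne hz
  · exact continuousAt_update_same.2 riemannZeta_residue_one

/-- The error of the trapezoidal rule for `(s - 1) x ^ (-s)` on `[a, a + 1]`. -/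
noncomputable def trapezoidTerm (a : ℝ) (s : ℂ) : ℂ :=
  (s - 1) / 2 * ((a : ℂ) ^ (-s) + ((a : ℂ) + 1) ^ (-s)) -
    ((a : ℂ) ^ (1 - s) - ((a : ℂ) + 1) ^ (1 - s))

theorem hasDerivAt_add_ofReal_cpow {a h : ℝ} (hah : 0 < a + h) (k : ℂ) :
    HasDerivAt (fun x : ℝ => ((a : ℂ) + x) ^ k) (k * ((a : ℂ) + h) ^ (k - 1)) h := by
  have h1 : HasDerivAt (fun z : ℂ => (a : ℂ) + z) 1 (h : ℂ) := (hasDerivAt_id _).const_add _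
  have h2 := (h1.cpow_const (c := k) (Or.inl (by simpa using hah))).comp_ofReal
  simpa using h2

/-- The trapezoidal rule is exact to second order, so its error is governed by the second derivative
of `x ^ (-s)`. The gain of two powers of `a` makes the series over `a = n + 1` converge for `Re s >
-1`. -/
theorem norm_trapezoidTerm_le {a : ℝ} (ha : 1 ≤ a) {s : ℂ} (hs : -2 ≤ s.re) :
    ‖trapezoidTerm a s‖ ≤ ‖s - 1‖ * ‖s‖ * ‖s + 1‖ * a ^ (-s.re - 2) := by
  have ha0 : 0 < a := by linarith
  have hpos : ∀ x : ℝ, 0 ≤ x → 0 < a + x := fun x hx => by linarith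
  -- With `φ x` the error on `[a, a + x]`, one has `φ' = (s - 1) / 2 * ψ`. Both vanish at `0`, so a
  -- bound for `ψ'` is integrated twice.
  set ψ : ℝ → ℂ := fun x => (a : ℂ) ^ (-s) - ((a : ℂ) + x) ^ (-s) - s * x * ((a : ℂ) + x) ^ (-s - 1)
  have hψ' : ∀ x : ℝ, 0 ≤ x →
      HasDerivAt ψ (s * (s + 1) * x * ((a : ℂ) + x) ^ (-s - 2)) x := by
    intro x hx
    have h1 := hasDerivAt_add_ofReal_cpow (hpos x hx) (-s)
    have h2 := hasDerivAt_add_ofReal_cpow (hpos x hx) (-s - 1)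
    have h3 : HasDerivAt (fun x : ℝ => s * (x : ℂ)) (s * 1) x :=
      ((hasDerivAt_id (x : ℂ)).const_mul s).comp_ofReal
    have h4 := (h1.const_sub ((a : ℂ) ^ (-s))).sub (h3.mul h2)
    refine h4.congr_deriv ?_
    rw [show -s - 1 - 1 = -s - 2 by ring]
    ring
  have hψ0 : ψ 0 = 0 := by simp [ψ]
  have hψ : ∀ x : ℝ, 0 ≤ x → x ≤ 1 → ‖ψ x‖ ≤ ‖s‖ * ‖s + 1‖ * a ^ (-s.re - 2) := by
    intro x hx hx1
    have := norm_image_sub_le_of_norm_deriv_le_segment' (f := ψ) (a := 0) (b := 1)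
      (C := ‖s‖ * ‖s + 1‖ * a ^ (-s.re - 2))
      (fun y hy => (hψ' y hy.1).hasDerivWithinAt) ?_ x ⟨hx, hx1⟩
    · rw [hψ0, sub_zero, sub_zero] at this
      refine this.trans (mul_le_of_le_one_right (by positivity) hx1)
    · intro y hy
      have hay : ‖((a : ℂ) + y) ^ (-s - 2)‖ ≤ a ^ (-s.re - 2) := by
        rw [← Complex.ofReal_add, Complex.norm_cpow_eq_rpow_re_of_pos (hpos y hy.1)]
        have : (-s - 2 : ℂ).re = -s.re - 2 := by simp
        rw [this]
        exact Real.rpow_le_rpow_of_nonpos ha0 (by linarith [hy.1]) (by linarith)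
      rw [norm_mul, norm_mul, norm_mul, Complex.norm_real, Real.norm_of_nonneg hy.1]
      have : ‖s‖ * ‖s + 1‖ * y ≤ ‖s‖ * ‖s + 1‖ := mul_le_of_le_one_right (by positivity) hy.2.le
      gcongr
  set φ : ℝ → ℂ := fun x => (s - 1) / 2 * (x * ((a : ℂ) ^ (-s) + ((a : ℂ) + x) ^ (-s))) -
    ((a : ℂ) ^ (1 - s) - ((a : ℂ) + x) ^ (1 - s))
  have hφ' : ∀ x : ℝ, 0 ≤ x → HasDerivAt φ ((s - 1) / 2 * ψ x) x := by
    intro x hx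
    have h1 := hasDerivAt_add_ofReal_cpow (hpos x hx) (-s)
    have h2 := hasDerivAt_add_ofReal_cpow (hpos x hx) (1 - s)
    have h3 : HasDerivAt (fun x : ℝ => (x : ℂ)) 1 x := (hasDerivAt_id (x : ℂ)).comp_ofReal
    have h4 := ((h3.mul (h1.const_add ((a : ℂ) ^ (-s)))).const_mul ((s - 1) / 2)).sub
      (h2.const_sub ((a : ℂ) ^ (1 - s)))
    refine h4.congr_deriv ?_
    rw [show 1 - s - 1 = -s by ring]
    simp only [ψ]
    ring
  have key := norm_image_sub_le_of_norm_deriv_le_segment_01' (f := φ)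
    (C := ‖s - 1‖ * (‖s‖ * ‖s + 1‖ * a ^ (-s.re - 2)))
    (fun y hy => (hφ' y hy.1).hasDerivWithinAt) (fun y hy => by
      rw [norm_mul]
      have : ‖(s - 1) / 2‖ ≤ ‖s - 1‖ := by
        rw [norm_div]; simp
      have := hψ y hy.1 hy.2.le
      gcongr)
  have hφ0 : φ 0 = 0 := by simp [φ]
  have hφ1 : φ 1 = trapezoidTerm a s := by simp [φ, trapezoidTerm]
  rw [hφ0, hφ1, sub_zero] at key
  linarith

theorem differentiable_trapezoidTerm {a : ℝ} (ha : 1 ≤ a) : Differentiable ℂ (trapezoidTerm a) := by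
  have h1 : (a : ℂ) ≠ 0 := by exact_mod_cast (by linarith : a ≠ 0)
  have h2 : (a : ℂ) + 1 ≠ 0 := by exact_mod_cast (by linarith : a + 1 ≠ 0)
  have e : ∀ {b : ℂ}, b ≠ 0 → ∀ {f : ℂ → ℂ}, Differentiable ℂ f →
      Differentiable ℂ fun s => b ^ f s := fun hb _ hf s => (hf s).const_cpow (Or.inl hb)
  unfold trapezoidTerm
  have i1 := e h1 (f := fun s => -s) (by fun_prop)
  have i2 := e h2 (f := fun s => -s) (by fun_prop)
  have i3 := e h1 (f := fun s => 1 - s) (by fun_prop)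
  have i4 := e h2 (f := fun s => 1 - s) (by fun_prop)
  fun_prop

/-- The end-point values add up to `ζ(s) + (ζ(s) - 1)`, and the exact integrals telescope to `1`. -/
theorem hasSum_trapezoidTerm {s : ℂ} (hs : 1 < s.re) :
    HasSum (fun n : ℕ => trapezoidTerm (n + 1) s) ((s - 1) * riemannZeta s - 1 - (s - 1) / 2) := by
  set f : ℕ → ℂ := fun n => ((n : ℂ) + 1) ^ (-s)
  have hf : HasSum f (riemannZeta s) := by
    rw [zeta_eq_tsum_one_div_nat_add_one_cpow hs]
    have h0 : Summable fun n : ℕ => 1 / (n : ℂ) ^ s := Complex.summable_one_div_nat_cpow.2 hs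
    have := ((summable_nat_add_iff 1).2 h0).hasSum
    simp only [Nat.cast_add, Nat.cast_one] at this
    refine this.congr_fun fun n => ?_
    simp [f, Complex.cpow_neg]
  have hf1 : HasSum (fun n => f (n + 1)) (riemannZeta s - 1) := by
    have := (hasSum_nat_add_iff' 1).2 hf
    simpa [f] using this
  have hU : Summable fun n : ℕ => trapezoidTerm (n + 1) s := by
    have h0 : Summable fun n : ℕ => ((n : ℝ) + 1) ^ (-s.re - 2) := by
      simpa using (summable_nat_add_iff 1).2 (Real.summable_nat_rpow.2 (by linarith : -s.re - 2 < -1))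
    refine Summable.of_norm_bounded (h0.mul_left (‖s - 1‖ * ‖s‖ * ‖s + 1‖)) fun n => ?_
    exact norm_trapezoidTerm_le (by linarith [n.cast_nonneg (α := ℝ)]) (by linarith)
  have hfun : ∀ n : ℕ, trapezoidTerm (n + 1) s = (s - 1) / 2 * (f n + f (n + 1)) -
      (((n : ℂ) + 1) ^ (1 - s) - ((n : ℂ) + 1 + 1) ^ (1 - s)) := by
    intro n; simp [f, trapezoidTerm]
  have ht : HasSum (fun n : ℕ => ((n : ℂ) + 1) ^ (1 - s) - ((n : ℂ) + 1 + 1) ^ (1 - s)) 1 := by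
    have hsum : Summable (fun n : ℕ => ((n : ℂ) + 1) ^ (1 - s) - ((n : ℂ) + 1 + 1) ^ (1 - s)) := by
      refine (((hf.add hf1).summable.mul_left ((s - 1) / 2)).sub hU).congr fun n => ?_
      rw [hfun]; ring
    have hlim : Tendsto (fun n : ℕ => ((n : ℂ) + 1) ^ (1 - s)) atTop (𝓝 0) := by
      rw [tendsto_zero_iff_norm_tendsto_zero]
      have h1 : Tendsto (fun n : ℕ => ((n : ℝ) + 1) ^ (-(s.re - 1))) atTop (𝓝 0) :=
        (tendsto_rpow_neg_atTop (by linarith)).comp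
          (tendsto_atTop_add_const_right _ _ tendsto_natCast_atTop_atTop)
      refine h1.congr fun n => ?_
      have : ((n : ℂ) + 1) = ((n + 1 : ℝ) : ℂ) := by push_cast; rfl
      rw [this, Complex.norm_cpow_eq_rpow_re_of_pos (by positivity)]
      simp
    refine (hsum.hasSum_iff_tendsto_nat).2 ?_
    have h2 := (hlim.const_sub (1 : ℂ))
    rw [sub_zero] at h2
    refine h2.congr fun n => ?_
    have h3 := Finset.sum_range_sub' (fun n : ℕ => ((n : ℂ) + 1) ^ (1 - s)) n
    simp only [Nat.cast_zero, zero_add, Complex.one_cpow, Nat.cast_add, Nat.cast_one] at h3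
    exact h3.symm
  have h := ((hf.add hf1).mul_left ((s - 1) / 2)).sub ht
  rw [show (s - 1) * riemannZeta s - 1 - (s - 1) / 2 =
    (s - 1) / 2 * (riemannZeta s + (riemannZeta s - 1)) - 1 by ring]
  exact h.congr_fun hfun

/-- Analytic continuation of the identity from `Re s > 1`. Reaching past `-1/2` matters because `1 -
2w` has real part down to `-1/2` when `Re w < 3/4`. -/
theorem zetaReg_eq_tsum {s : ℂ} (hs : -3 / 4 < s.re) :
    zetaReg s = 1 + (s - 1) / 2 + ∑' n : ℕ, trapezoidTerm (n + 1) s := by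
  set R : ℝ := ‖s‖ + 3
  -- The ball bounds the polynomial factor of the terms uniformly, so that the majorant `(n + 1) ^
  -- (-5/4)` applies. The radius is large enough for `U` to contain both `s` and `2`.
  set U : Set ℂ := {z | -3 / 4 < z.re} ∩ Metric.ball 0 R
  have hUo : IsOpen U := (isOpen_lt continuous_const Complex.continuous_re).inter Metric.isOpen_ball
  have hUc : Convex ℝ U := (convex_halfSpace_re_gt _).inter (convex_ball _ _)
  have hsum : Summable fun n : ℕ => (R + 1) * R * (R + 1) * ((n : ℝ) + 1) ^ (-5 / 4 : ℝ) := by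
    refine Summable.mul_left _ ?_
    simpa using (summable_nat_add_iff 1).2 (Real.summable_nat_rpow.2 (by norm_num : (-5 / 4 : ℝ) < -1))
  have hR : 0 < R := by positivity
  have hd : DifferentiableOn ℂ (fun z => ∑' n : ℕ, trapezoidTerm (n + 1) z) U := by
    refine Complex.differentiableOn_tsum_of_summable_norm hsum (fun n => ?_) hUo fun n z hz => ?_
    · exact (differentiable_trapezoidTerm
        (by linarith [n.cast_nonneg (α := ℝ)])).differentiableOn
    · have hz1 : -3 / 4 < z.re := hz.1
      have hz2 : ‖z‖ ≤ R := (by simpa using hz.2 : ‖z‖ < R).le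
      refine (norm_trapezoidTerm_le (by linarith [n.cast_nonneg (α := ℝ)]) (by linarith)).trans ?_
      have h1 : ‖z - 1‖ ≤ R + 1 := (norm_sub_le _ _).trans (by simpa using hz2)
      have h2 : ‖z + 1‖ ≤ R + 1 := (norm_add_le _ _).trans (by simpa using hz2)
      have h3 : ((n : ℝ) + 1) ^ (-z.re - 2) ≤ ((n : ℝ) + 1) ^ (-5 / 4 : ℝ) :=
        Real.rpow_le_rpow_of_exponent_le (by linarith [n.cast_nonneg (α := ℝ)]) (by linarith)
      gcongr
  have ha1 : AnalyticOnNhd ℂ zetaReg U := differentiable_zetaReg.differentiableOn.analyticOnNhd hUo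
  have ha2 : AnalyticOnNhd ℂ
      (fun z => 1 + (z - 1) / 2 + ∑' n : ℕ, trapezoidTerm (n + 1) z) U := by
    refine DifferentiableOn.analyticOnNhd ?_ hUo
    exact DifferentiableOn.add (by fun_prop) hd
  have h2 : (2 : ℂ) ∈ U := by
    refine ⟨by norm_num [Set.mem_ofPred_eq], ?_⟩
    simp only [Metric.mem_ball, dist_zero_right, Complex.norm_ofNat, R]
    linarith [norm_nonneg s]
  refine ha1.eqOn_of_preconnected_of_eventuallyEq ha2 hUc.isPreconnected h2 ?_ ⟨hs, by simp [R]⟩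
  have : {z : ℂ | 1 < z.re} ∈ 𝓝 (2 : ℂ) :=
    (isOpen_lt continuous_const Complex.continuous_re).mem_nhds (by norm_num [Set.mem_ofPred_eq])
  filter_upwards [this] with z hz
  have hz' : 1 < z.re := hz
  rw [(hasSum_trapezoidTerm hz').tsum_eq, zetaReg_of_ne (by rintro rfl; simp at hz')]
  ring

theorem exists_norm_zetaReg_le :
    ∃ C : ℝ, 1 ≤ C ∧ ∀ s : ℂ, -1 / 2 ≤ s.re → ‖zetaReg s‖ ≤ C * (1 + ‖s‖) ^ 3 := by
  have hsum : Summable fun n : ℕ => ((n : ℝ) + 1) ^ (-3 / 2 : ℝ) := by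
    simpa using (summable_nat_add_iff 1).2 (Real.summable_nat_rpow.2 (by norm_num : (-3 / 2 : ℝ) < -1))
  set T := ∑' n : ℕ, ((n : ℝ) + 1) ^ (-3 / 2 : ℝ)
  have hT : 0 ≤ T := tsum_nonneg fun n => by positivity
  refine ⟨2 + T, by linarith, fun s hs => ?_⟩
  have h1 : ‖s - 1‖ ≤ 1 + ‖s‖ := (norm_sub_le _ _).trans (by simp [add_comm])
  have h2 : ‖s + 1‖ ≤ 1 + ‖s‖ := (norm_add_le _ _).trans (by simp [add_comm])
  have h3 : ‖∑' n : ℕ, trapezoidTerm (n + 1) s‖ ≤ (1 + ‖s‖) ^ 3 * T := by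
    refine tsum_of_norm_bounded (hsum.hasSum.mul_left _) fun n => ?_
    refine (norm_trapezoidTerm_le (by linarith [n.cast_nonneg (α := ℝ)]) (by linarith)).trans ?_
    have h4 : ((n : ℝ) + 1) ^ (-s.re - 2) ≤ ((n : ℝ) + 1) ^ (-3 / 2 : ℝ) :=
      Real.rpow_le_rpow_of_exponent_le (by linarith [n.cast_nonneg (α := ℝ)]) (by linarith)
    have h5 : ‖s‖ ≤ 1 + ‖s‖ := by linarith
    calc _ ≤ (1 + ‖s‖) * (1 + ‖s‖) * (1 + ‖s‖) * ((n : ℝ) + 1) ^ (-3 / 2 : ℝ) := by gcongr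
      _ = _ := by ring
  rw [zetaReg_eq_tsum (by linarith)]
  have h6 : ‖(s - 1) / 2‖ ≤ 1 + ‖s‖ := by
    rw [norm_div, Complex.norm_ofNat]
    linarith [norm_nonneg (s - 1)]
  have h7 : (1 + ‖s‖) ≤ (1 + ‖s‖) ^ 3 := le_self_pow₀ (by linarith [norm_nonneg s]) (by norm_num)
  have h8 : (1 : ℝ) ≤ 1 + ‖s‖ := by linarith [norm_nonneg s]
  calc _ ≤ ‖(1 : ℂ)‖ + ‖(s - 1) / 2‖ + ‖∑' n : ℕ, trapezoidTerm (n + 1) s‖ := norm_add₃_le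
    _ ≤ (1 + ‖s‖) ^ 3 + (1 + ‖s‖) ^ 3 + (1 + ‖s‖) ^ 3 * T := by
      rw [norm_one]; gcongr <;> linarith
    _ = _ := by ring

/-! ### Lower bound for `ζ` to the right of the critical line under RH. -/

/-- A holomorphic function without zeros in a disc that is not much larger than at the centre is
not much smaller either. -/
theorem norm_center_le_of_nonvanishing {F : ℂ → ℂ} {s₀ s : ℂ} {R B : ℝ} (hB : 1 < B)
    (hF : DifferentiableOn ℂ F (Metric.ball s₀ R)) (hF0 : ∀ z ∈ Metric.ball s₀ R, F z ≠ 0)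
    (hFB : ∀ z ∈ Metric.ball s₀ R, ‖F z‖ ≤ B * ‖F s₀‖) (hs : s ∈ Metric.ball s₀ R) :
    ‖F s₀‖ ≤ ‖F s‖ * B ^ (2 * ‖s - s₀‖ / (R - ‖s - s₀‖)) := by
  have hR : 0 < R := Metric.pos_of_mem_ball hs
  have hs₀ : s₀ ∈ Metric.ball s₀ R := Metric.mem_ball_self hR
  -- A primitive of `F' / F` is a logarithm `h` of `F / F s₀` with `h s₀ = 0`. The hypothesis gives
  -- `Re h ≤ log B`, and Borel–Carathéodory turns this into a bound for `|h|`.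
  have hq : DifferentiableOn ℂ (fun z => deriv F z / F z) (Metric.ball s₀ R) :=
    (hF.deriv Metric.isOpen_ball).div hF hF0
  obtain ⟨h, h0, hh⟩ := hq.isExactOn_ball.with_val_at s₀ 0
  have hexp : ∀ z ∈ Metric.ball s₀ R, F z = F s₀ * Complex.exp (h z) := by
    intro z hz
    have hd : ∀ z ∈ Metric.ball s₀ R, HasDerivAt (fun z => F z * Complex.exp (-h z)) 0 z := by
      intro z hz
      have h1 := (hF.differentiableAt (Metric.isOpen_ball.mem_nhds hz)).hasDerivAt
      have h2 := (hh z hz).neg.cexp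
      refine (h1.mul h2).congr_deriv ?_
      have := hF0 z hz
      field_simp
      ring
    have := Metric.isOpen_ball.is_const_of_deriv_eq_zero (convex_ball s₀ R).isPreconnected
      (fun z hz => (hd z hz).differentiableAt.differentiableWithinAt)
      (fun z hz => (hd z hz).deriv) hz hs₀
    simp only [h0, neg_zero, Complex.exp_zero, mul_one] at this
    rw [← this, mul_assoc, ← Complex.exp_add, neg_add_cancel, Complex.exp_zero, mul_one]
  have hF0' : 0 < ‖F s₀‖ := norm_pos_iff.2 (hF0 s₀ hs₀)
  have hlog : 0 < Real.log B := Real.log_pos hB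
  have hmem : ∀ z ∈ Metric.ball (0 : ℂ) R, z + s₀ ∈ Metric.ball s₀ R := fun z hz => by
    simpa using hz
  have hbc := Complex.borelCaratheodory_zero (f := fun z => h (z + s₀)) (z := s - s₀) hlog
    (R := R) (fun z hz => ((hh _ (hmem z hz)).comp_add_const z s₀).differentiableAt.differentiableWithinAt)
    (fun z hz => by
      have h1 := hFB _ (hmem z hz)
      rw [hexp _ (hmem z hz), norm_mul, Complex.norm_exp, mul_comm] at h1
      have h2 := le_of_mul_le_mul_right h1 hF0'
      exact (Real.le_log_iff_exp_le (by linarith)).2 h2) hR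
    (by simpa [dist_eq_norm] using hs) (by simpa using h0)
  simp only [sub_add_cancel] at hbc
  rw [hexp s hs, norm_mul, Complex.norm_exp, mul_assoc]
  refine le_mul_of_one_le_right hF0'.le ?_
  rw [Real.rpow_def_of_pos (by linarith), ← Real.exp_add]
  refine Real.one_le_exp ?_
  have h3 := (Complex.abs_re_le_norm (h s)).trans hbc
  have h4 := neg_le_of_abs_le h3
  have : 2 * Real.log B * ‖s - s₀‖ / (R - ‖s - s₀‖) =
    Real.log B * (2 * ‖s - s₀‖ / (R - ‖s - s₀‖)) := by ring
  linarith

theorem zetaReg_ne_zero (hRH : RiemannHypothesis) {s : ℂ} (hs : 1 / 2 < s.re) :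
    zetaReg s ≠ 0 := by
  rcases eq_or_ne s 1 with rfl | h1
  · simp [zetaReg_one]
  rw [zetaReg_of_ne h1]
  refine mul_ne_zero (sub_ne_zero.2 h1) fun h => ?_
  have := hRH s h (by
    rintro ⟨n, rfl⟩
    have : (-2 * ((n : ℂ) + 1)).re = -2 * ((n : ℝ) + 1) := by simp
    rw [this] at hs
    have := n.cast_nonneg (α := ℝ)
    linarith) h1
  linarith

/-- On `Re s = 2`, `|ζ(s) - 1| ≤ π² / 6 - 1 ≤ 0.7` and `|s - 1| ≥ 1`. This supplies the centres of
the discs for Borel–Carathéodory. -/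
theorem quarter_le_norm_zetaReg (t : ℝ) : 1 / 4 ≤ ‖zetaReg (2 + t * Complex.I)‖ := by
  set s : ℂ := 2 + t * Complex.I
  have hre : s.re = 2 := by simp [s]
  have h1 : s ≠ 1 := fun h => by rw [h] at hre; norm_num at hre
  rw [zetaReg_of_ne h1, norm_mul]
  have hs1 : 1 ≤ ‖s - 1‖ := by
    refine le_trans (le_of_eq ?_) (Complex.re_le_norm _)
    simp [hre]; norm_num
  have h2 : HasSum (fun n : ℕ => 1 / ((n : ℂ) + 1 + 1) ^ s) (riemannZeta s - 1) := by
    rw [zeta_eq_tsum_one_div_nat_add_one_cpow (by rw [hre]; norm_num)]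
    have h0 : Summable fun n : ℕ => 1 / (n : ℂ) ^ s :=
      Complex.summable_one_div_nat_cpow.2 (by rw [hre]; norm_num)
    have := (hasSum_nat_add_iff' 1).2 ((summable_nat_add_iff 1).2 h0).hasSum
    simpa using this
  have h3 : HasSum (fun n : ℕ => 1 / ((n : ℝ) + 1 + 1) ^ 2) (Real.pi ^ 2 / 6 - 1) := by
    have := (hasSum_nat_add_iff' 2).2 hasSum_zeta_two
    simpa [Finset.sum_range_succ, add_assoc, one_add_one_eq_two] using this
  have h4 : ‖riemannZeta s - 1‖ ≤ Real.pi ^ 2 / 6 - 1 := by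
    rw [← h2.tsum_eq]
    refine tsum_of_norm_bounded h3 fun n => le_of_eq ?_
    have : (n : ℂ) + 1 + 1 = ((n + 1 + 1 : ℝ) : ℂ) := by push_cast; rfl
    rw [norm_div, this, Complex.norm_cpow_eq_rpow_re_of_pos (by positivity), hre]
    simp
  have h5 : 1 - ‖riemannZeta s - 1‖ ≤ ‖riemannZeta s‖ := by
    have := norm_sub_norm_le (1 : ℂ) (1 - riemannZeta s)
    rw [norm_one, sub_sub_cancel, norm_sub_rev] at this
    exact this
  have h6 : Real.pi ^ 2 / 6 ≤ 1.7 := by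
    have := Real.pi_lt_d2
    nlinarith [Real.pi_pos]
  nlinarith [norm_nonneg (riemannZeta s)]

theorem exists_le_norm_zetaReg (hRH : RiemannHypothesis) {δ : ℝ} (hδ : 0 < δ) :
    ∃ (C : ℝ) (A : ℕ), 0 < C ∧ ∀ s : ℂ, 1 / 2 + δ ≤ s.re → s.re ≤ 2 →
      1 ≤ C * (1 + ‖s‖) ^ A * ‖zetaReg s‖ := by
  obtain ⟨C, hC, hCb⟩ := exists_norm_zetaReg_le
  -- For the disc of radius `R = 3/2 - δ/2` about `2 + i Im s`, the distance of `s` from the centre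
  -- is at most `3/2 - δ`. The exponent is thus at most `2 * (3/2) / (δ/2) = 6 / δ`.
  obtain ⟨A, hA⟩ := exists_nat_ge (6 / δ)
  refine ⟨4 * (4 * C * 5 ^ 3) ^ A, 3 * A, by positivity, fun s hs1 hs2 => ?_⟩
  set s₀ : ℂ := 2 + s.im * Complex.I
  set R : ℝ := 3 / 2 - δ / 2
  set B : ℝ := 4 * C * (5 * (1 + ‖s‖)) ^ 3
  have hn := norm_nonneg s
  have h5 : 1 ≤ (5 * (1 + ‖s‖)) ^ 3 := one_le_pow₀ (by linarith)
  have hB : 1 < B := by simp only [B]; nlinarith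
  have hdist : ‖s - s₀‖ = 2 - s.re := by
    have : s - s₀ = ((s.re - 2 : ℝ) : ℂ) := by
      apply Complex.ext <;> simp [s₀]
    rw [this, Complex.norm_real, Real.norm_eq_abs, abs_of_nonpos (by linarith)]
    ring
  have hz : ∀ z ∈ Metric.ball s₀ R, 1 / 2 < z.re ∧ ‖z‖ ≤ 4 + ‖s‖ := by
    intro z hz
    rw [Metric.mem_ball, dist_eq_norm] at hz
    constructor
    · have := (Complex.abs_re_le_norm (z - s₀)).trans hz.le
      have := neg_le_of_abs_le this
      simp [s₀, R] at this
      linarith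
    · have h1 : ‖z‖ ≤ ‖z - s₀‖ + ‖s₀ - s‖ + ‖s‖ := by
        have := norm_add₃_le (a := z - s₀) (b := s₀ - s) (c := s)
        simpa using this
      rw [norm_sub_rev s₀ s, hdist] at h1
      simp only [R] at hz
      linarith
  have hq := quarter_le_norm_zetaReg s.im
  have key := norm_center_le_of_nonvanishing (F := zetaReg) (s₀ := s₀) (s := s) (R := R) hB
    differentiable_zetaReg.differentiableOn (fun z h => zetaReg_ne_zero hRH (hz z h).1)
    (fun z h => by
      refine (hCb z (by linarith [(hz z h).1])).trans ?_
      have h1 : (1 + ‖z‖) ^ 3 ≤ (5 * (1 + ‖s‖)) ^ 3 := by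
        have := (hz z h).2
        gcongr
        linarith
      calc C * (1 + ‖z‖) ^ 3 ≤ C * (5 * (1 + ‖s‖)) ^ 3 := by gcongr
        _ = B * (1 / 4) := by simp only [B]; ring
        _ ≤ _ := by gcongr)
    (by rw [Metric.mem_ball, dist_eq_norm, hdist]; simp only [R]; linarith)
  have hexp : 2 * ‖s - s₀‖ / (R - ‖s - s₀‖) ≤ A := by
    refine le_trans ?_ hA
    rw [hdist, div_le_div_iff₀ (by simp only [R]; linarith) hδ]
    simp only [R]
    nlinarith
  have hpow : B ^ (2 * ‖s - s₀‖ / (R - ‖s - s₀‖)) ≤ B ^ A := by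
    rw [← Real.rpow_natCast]
    exact Real.rpow_le_rpow_of_exponent_le hB.le hexp
  have : 1 / 4 ≤ ‖zetaReg s‖ * B ^ A := hq.trans (key.trans (by gcongr))
  have hBA : B ^ A = (4 * C * 5 ^ 3) ^ A * (1 + ‖s‖) ^ (3 * A) := by
    simp only [B]; rw [pow_mul, ← mul_pow]; ring
  rw [hBA] at this
  calc (1 : ℝ) = 4 * (1 / 4) := by norm_num
    _ ≤ 4 * (‖zetaReg s‖ * ((4 * C * 5 ^ 3) ^ A * (1 + ‖s‖) ^ (3 * A))) := by gcongr
    _ = _ := by ring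

/-! ### The arithmetic factor and the Gamma quotient. -/

/-- Each local factor equals `(1 - p ^ (-(2 - 2r))) / (1 - p ^ (-2))`; both Euler products converge
since `Re (2 - 2r) > 1`. -/
theorem arithFactor_eq {r : ℂ} (hr : r.re < 1 / 2) :
    arithFactor r = riemannZeta 2 / riemannZeta (2 - 2 * r) := by
  have h2 : 1 < (2 : ℂ).re := by norm_num
  have hs : 1 < (2 - 2 * r).re := by simp; linarith
  have h := (riemannZeta_eulerProduct_hasProd h2).mul
    ((riemannZeta_eulerProduct_hasProd hs).inv₀ (riemannZeta_ne_zero_of_one_lt_re hs))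
  rw [div_eq_mul_inv, arithFactor, ← h.tprod_eq]
  refine tprod_congr fun p => ?_
  have hp : (p : ℂ) ≠ 0 := by exact_mod_cast p.2.ne_zero
  have hp1 : (p : ℂ) + 1 ≠ 0 := by exact_mod_cast (p : ℕ).succ_ne_zero
  have hp2 : (p : ℂ) - 1 ≠ 0 := by
    rw [sub_ne_zero]; exact_mod_cast p.2.one_lt.ne'
  have e1 : (p : ℂ) ^ (1 - 2 * r) = (p : ℂ) * (p : ℂ) ^ (-2 * r) := by
    rw [sub_eq_add_neg, Complex.cpow_add _ _ hp, Complex.cpow_one, neg_mul]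
  have e2 : (p : ℂ) ^ (-(2 - 2 * r)) = ((p : ℂ) ^ 2 * (p : ℂ) ^ (-2 * r))⁻¹ := by
    rw [Complex.cpow_neg, sub_eq_add_neg, Complex.cpow_add _ _ hp, neg_mul]
    norm_cast
  have e3 : (p : ℂ) ^ (-2 : ℂ) = ((p : ℂ) ^ 2)⁻¹ := by
    rw [Complex.cpow_neg]; norm_cast
  have hc : (p : ℂ) ^ (-2 * r) ≠ 0 := by simp [Complex.cpow_eq_zero_iff, hp]
  rw [inv_inv, e1, e2, e3]
  have hp3 : (p : ℂ) ^ 2 - 1 ≠ 0 := by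
    rw [show (p : ℂ) ^ 2 - 1 = (p + 1) * (p - 1) by ring]
    exact mul_ne_zero hp1 hp2
  field_simp
  ring

theorem norm_betaIntegral_le (u : ℂ) (v : ℝ) :
    ‖Complex.betaIntegral u v‖ ≤ ‖Complex.betaIntegral u.re v‖ := by
  have hpt : ∀ x : ℝ, x ∈ Set.Ioo (0 : ℝ) 1 →
      ‖(x : ℂ) ^ (u - 1) * (1 - (x : ℂ)) ^ ((v : ℂ) - 1)‖ = x ^ (u.re - 1) * (1 - x) ^ (v - 1) := by
    intro x hx
    have h1 : 0 < 1 - x := by linarith [hx.2]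
    have h2 : (1 - (x : ℂ)) = ((1 - x : ℝ) : ℂ) := by push_cast; rfl
    rw [norm_mul, h2, Complex.norm_cpow_eq_rpow_re_of_pos hx.1,
      Complex.norm_cpow_eq_rpow_re_of_pos h1]
    simp
  have hre : Complex.betaIntegral u.re v =
      ((∫ x in (0 : ℝ)..1, x ^ (u.re - 1) * (1 - x) ^ (v - 1) : ℝ) : ℂ) := by
    rw [Complex.betaIntegral, ← intervalIntegral.integral_ofReal]
    refine intervalIntegral.integral_congr fun x hx => ?_
    rw [Set.uIcc_of_le zero_le_one] at hx
    push_cast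
    rw [Complex.ofReal_cpow hx.1, Complex.ofReal_cpow (by linarith [hx.2])]
    push_cast
    rfl
  rw [hre, Complex.norm_real]
  refine le_trans ?_ (le_abs_self _)
  rw [Complex.betaIntegral]
  refine (intervalIntegral.norm_integral_le_integral_norm zero_le_one).trans (le_of_eq ?_)
  rw [intervalIntegral.integral_of_le zero_le_one, intervalIntegral.integral_of_le zero_le_one,
    integral_Ioc_eq_integral_Ioo, integral_Ioc_eq_integral_Ioo]
  exact setIntegral_congr_fun measurableSet_Ioo hpt

/-- On a fixed horizontal line, `‖Γ‖` grows to the right at least as fast as on the real axis. -/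
theorem norm_Gamma_mul_Gamma_le {u : ℂ} (hu : 0 < u.re) {v : ℝ} (hv : 0 ≤ v) :
    ‖Complex.Gamma u‖ * Real.Gamma (u.re + v) ≤ ‖Complex.Gamma (u + v)‖ * Real.Gamma u.re := by
  rcases hv.eq_or_lt with rfl | hv
  · simp
  have h1 := congrArg norm (Complex.Gamma_mul_Gamma_eq_betaIntegral hu (t := v) (by simpa using hv))
  have h2 := congrArg norm (Complex.Gamma_mul_Gamma_eq_betaIntegral (s := u.re) (t := v)
    (by simpa using hu) (by simpa using hv))
  rw [← Complex.ofReal_add] at h2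
  simp only [norm_mul, Complex.Gamma_ofReal, Complex.norm_real] at h1 h2
  have p1 := Real.Gamma_pos_of_pos hv
  have p2 := Real.Gamma_pos_of_pos hu
  have p3 := Real.Gamma_pos_of_pos (add_pos hu hv)
  simp only [Real.norm_of_nonneg p1.le, Real.norm_of_nonneg p2.le, Real.norm_of_nonneg p3.le]
    at h1 h2
  have h3 := norm_betaIntegral_le u v
  refine le_of_mul_le_mul_right ?_ p1
  calc _ = (‖Complex.Gamma u‖ * Real.Gamma v) * Real.Gamma (u.re + v) := by ring
    _ = ‖Complex.Gamma (u + v)‖ * (Real.Gamma (u.re + v) * ‖Complex.betaIntegral u v‖) := by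
      rw [h1]; ring
    _ ≤ ‖Complex.Gamma (u + v)‖ * (Real.Gamma (u.re + v) * ‖Complex.betaIntegral u.re v‖) := by
      gcongr
    _ = _ := by rw [← h2]; ring

/-- No Stirling formula is needed: up to conjugation, `5/4 - w/2` and `5/4 + w/2` lie on one
horizontal line, where `norm_Gamma_mul_Gamma_le` reduces the quotient to real arguments in a compact
range. Passing from `5/4 + w/2` to `1/4 + w/2` costs one linear factor. -/
theorem exists_norm_Gamma_div_Gamma_le :
    ∃ C : ℝ, 0 < C ∧ ∀ w : ℂ, 0 ≤ w.re → w.re ≤ 3 / 4 →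
      ‖Complex.Gamma (5 / 4 - w / 2) / Complex.Gamma (1 / 4 + w / 2)‖ ≤ C * (1 + ‖w‖) := by
  have hcont : ContinuousOn (fun c : ℝ => Real.Gamma (5 / 4 - c / 2) / Real.Gamma (5 / 4 + c / 2))
      (Set.Icc 0 (3 / 4)) := by
    have hG : ∀ x : ℝ, 0 < x → ContinuousAt Real.Gamma x := fun x hx =>
      (Real.differentiableAt_Gamma fun m => ne_of_gt (by linarith [m.cast_nonneg (α := ℝ)])).continuousAt
    intro c hc
    refine ContinuousAt.continuousWithinAt (ContinuousAt.div ?_ ?_ ?_)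
    · exact ContinuousAt.comp (f := fun c : ℝ => 5 / 4 - c / 2) (hG _ (by linarith [hc.2]))
        (by fun_prop)
    · exact ContinuousAt.comp (f := fun c : ℝ => 5 / 4 + c / 2) (hG _ (by linarith [hc.1]))
        (by fun_prop)
    · exact (Real.Gamma_pos_of_pos (by linarith [hc.1])).ne'
  obtain ⟨K, hK⟩ := isCompact_Icc.exists_bound_of_continuousOn hcont
  refine ⟨|K| + 1, by positivity, fun w h0 h1 => ?_⟩
  -- Conjugation preserves `‖Γ‖` and matches the imaginary parts, so that `u + Re w = 5/4 + w/2`.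
  set u : ℂ := (starRingEnd ℂ) (5 / 4 - w / 2)
  have hure : u.re = 5 / 4 - w.re / 2 := by
    simp only [u, Complex.conj_re]; simp
  have huim : u.im = w.im / 2 := by
    simp only [u, Complex.conj_im]; simp
  have huv : u + (w.re : ℝ) = 5 / 4 + w / 2 := by
    apply Complex.ext
    · simp [hure]; ring
    · simp [huim]
  have hg := norm_Gamma_mul_Gamma_le (u := u) (by rw [hure]; linarith) h0
  have hru : u.re + w.re = 5 / 4 + w.re / 2 := by rw [hure]; ring
  rw [huv, Complex.Gamma_conj, RCLike.norm_conj, hru, hure] at hg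
  have hz : 0 < ‖1 / 4 + w / 2‖ := by
    rw [norm_pos_iff]
    intro h
    have := congrArg Complex.re h
    simp at this
    linarith
  have hrec : Complex.Gamma (5 / 4 + w / 2) = (1 / 4 + w / 2) * Complex.Gamma (1 / 4 + w / 2) := by
    rw [← Complex.Gamma_add_one _ (norm_pos_iff.1 hz)]; congr 1; ring
  rw [hrec, norm_mul] at hg
  have hG2 : 0 < ‖Complex.Gamma (1 / 4 + w / 2)‖ := norm_pos_iff.2
    (Complex.Gamma_ne_zero_of_re_pos (by simp; linarith))
  have p3 : 0 < Real.Gamma (5 / 4 + w.re / 2) := Real.Gamma_pos_of_pos (by linarith)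
  have hKw := (le_abs_self _).trans (hK w.re ⟨h0, h1⟩)
  rw [norm_div, div_le_iff₀ hG2]
  have hq : ‖1 / 4 + w / 2‖ ≤ 1 + ‖w‖ := by
    refine (norm_add_le _ _).trans ?_
    have := norm_nonneg w
    simp only [norm_div, norm_one, Complex.norm_ofNat]
    linarith
  calc ‖Complex.Gamma (5 / 4 - w / 2)‖
      ≤ ‖1 / 4 + w / 2‖ * ‖Complex.Gamma (1 / 4 + w / 2)‖ *
        (Real.Gamma (5 / 4 - w.re / 2) / Real.Gamma (5 / 4 + w.re / 2)) := by
        rw [mul_div_assoc', le_div_iff₀ p3]; exact hg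
    _ ≤ (1 + ‖w‖) * ‖Complex.Gamma (1 / 4 + w / 2)‖ * (|K| + 1) := by
        have : Real.Gamma (5 / 4 - w.re / 2) / Real.Gamma (5 / 4 + w.re / 2) ≤ |K| + 1 := by
          linarith [le_abs_self K]
        have := (Real.Gamma_pos_of_pos (by linarith : 0 < 5 / 4 - w.re / 2)).le
        gcongr
    _ = _ := by ring

/-! ### Paley–Wiener bounds for the extension of `g` to the complex plane. -/

/-- The Fourier–Laplace transform `z ↦ ∫ φ(ξ) e^{2πizξ} dξ`. -/
noncomputable def fourierLaplace (φ : 𝓢(ℝ, ℂ)) (z : ℂ) : ℂ :=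
  ∫ ξ : ℝ, φ ξ * Complex.exp (2 * Real.pi * Complex.I * z * ξ)

theorem fourierLaplace_fourier (g : 𝓢(ℝ, ℂ)) (x : ℝ) :
    fourierLaplace (𝓕 g : 𝓢(ℝ, ℂ)) x = g x := by
  have h : (𝓕⁻ (𝓕 g : 𝓢(ℝ, ℂ)) : 𝓢(ℝ, ℂ)) x = g x := by
    rw [FourierTransform.fourierInv_fourier_eq]
  rw [← h, SchwartzMap.fourierInv_coe, Real.fourierInv_eq', fourierLaplace]
  refine integral_congr_ae (Eventually.of_forall fun ξ => ?_)
  simp only [smul_eq_mul]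
  rw [mul_comm]
  congr 2
  simp
  ring

section

variable {φ : 𝓢(ℝ, ℂ)} {σ : ℝ}

theorem hasCompactSupport_of_tsupport_subset_Ioo (hφ : tsupport φ ⊆ Set.Ioo (-σ) σ) :
    HasCompactSupport φ :=
  isCompact_Icc.of_isClosed_subset (isClosed_tsupport _) (hφ.trans Set.Ioo_subset_Icc_self)

theorem integrable_mul_of_tsupport_subset_Ioo (hφ : tsupport φ ⊆ Set.Ioo (-σ) σ) {f : ℝ → ℂ}
    (hf : Continuous f) : Integrable fun ξ => φ ξ * f ξ :=
  (φ.continuous.mul hf).integrable_of_hasCompactSupport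
    (hasCompactSupport_of_tsupport_subset_Ioo hφ).mul_right

theorem differentiable_fourierLaplace (hφ : tsupport φ ⊆ Set.Ioo (-σ) σ) :
    Differentiable ℂ (fourierLaplace φ) := by
  intro z₀
  set B : ℝ → ℂ := fun ξ =>
    ((2 * Real.pi * |ξ| * Real.exp (2 * Real.pi * (‖z₀‖ + 1) * |ξ|) : ℝ) : ℂ)
  have hB : Integrable fun ξ => ‖φ ξ * B ξ‖ :=
    (integrable_mul_of_tsupport_subset_Ioo hφ (by fun_prop)).norm
  refine (hasDerivAt_integral_of_dominated_loc_of_deriv_le (Metric.ball_mem_nhds z₀ one_pos)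
    (F' := fun z ξ => φ ξ * (Complex.exp (2 * Real.pi * Complex.I * z * ξ) *
      (2 * Real.pi * Complex.I * ξ)))
    (Eventually.of_forall fun z => ?_) ?_ ?_ ?_ hB ?_).2.differentiableAt
  · exact (integrable_mul_of_tsupport_subset_Ioo hφ (by fun_prop)).aestronglyMeasurable
  · exact integrable_mul_of_tsupport_subset_Ioo hφ (by fun_prop)
  · exact (integrable_mul_of_tsupport_subset_Ioo hφ (by fun_prop)).aestronglyMeasurable
  · refine Eventually.of_forall fun ξ z hz => ?_
    rw [norm_mul (φ ξ), norm_mul (φ ξ)]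
    refine mul_le_mul_of_nonneg_left ?_ (norm_nonneg (φ ξ))
    have hz' : ‖z‖ ≤ ‖z₀‖ + 1 := by
      rw [Metric.mem_ball, dist_eq_norm] at hz
      have := norm_le_norm_add_norm_sub' z z₀
      linarith
    have h1 : ‖Complex.exp (2 * Real.pi * Complex.I * z * ξ)‖ ≤
        Real.exp (2 * Real.pi * (‖z₀‖ + 1) * |ξ|) := by
      refine (Complex.norm_exp_le_exp_norm _).trans (Real.exp_le_exp.2 ?_)
      simp only [norm_mul, Complex.norm_ofNat, Complex.norm_real, Complex.norm_I, mul_one,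
        Real.norm_eq_abs, abs_of_pos Real.pi_pos]
      have := Real.pi_pos
      gcongr
    have h2 : ‖(2 * Real.pi * Complex.I * ξ : ℂ)‖ = 2 * Real.pi * |ξ| := by
      simp [abs_of_pos Real.pi_pos]
    rw [norm_mul, h2, Complex.norm_real, Real.norm_of_nonneg (by positivity), mul_comm]
    gcongr
  · refine Eventually.of_forall fun ξ z _ => ?_
    have h1 : HasDerivAt (fun z : ℂ => 2 * Real.pi * Complex.I * z * ξ)
        (2 * Real.pi * Complex.I * 1 * ξ) z :=
      ((hasDerivAt_id z).const_mul _).mul_const _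
    rw [mul_one] at h1
    exact h1.cexp.const_mul _

theorem norm_fourierLaplace_le (hφ : tsupport φ ⊆ Set.Ioo (-σ) σ) (z : ℂ) :
    ‖fourierLaplace φ z‖ ≤ (∫ ξ, ‖φ ξ‖) * Real.exp (2 * Real.pi * σ * |z.im|) := by
  rw [← integral_mul_const]
  refine norm_integral_le_of_norm_le (φ.integrable.norm.mul_const _)
    (Eventually.of_forall fun ξ => ?_)
  rw [norm_mul]
  by_cases hξ : φ ξ = 0
  · simp [hξ]
  have hmem := hφ (subset_tsupport _ hξ)
  have hre : (2 * Real.pi * Complex.I * z * ξ : ℂ).re = 2 * Real.pi * (-ξ * z.im) := by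
    simp; ring
  rw [Complex.norm_exp, hre]
  refine mul_le_mul_of_nonneg_left (Real.exp_le_exp.2 ?_) (norm_nonneg _)
  have h1 : -ξ * z.im ≤ σ * |z.im| := by
    refine (le_abs_self _).trans ?_
    rw [abs_mul, abs_neg]
    exact mul_le_mul_of_nonneg_right (abs_lt.2 hmem).le (abs_nonneg _)
  have := Real.pi_pos
  calc 2 * Real.pi * (-ξ * z.im) ≤ 2 * Real.pi * (σ * |z.im|) := by gcongr
    _ = _ := by ring

theorem tsupport_derivCLM_subset : tsupport (SchwartzMap.derivCLM ℂ ℂ φ) ⊆ tsupport φ := by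
  have : (SchwartzMap.derivCLM ℂ ℂ φ : ℝ → ℂ) = deriv φ := by
    funext x; simp
  rw [this]
  exact tsupport_deriv_subset

theorem fourierLaplace_derivCLM (hφ : tsupport φ ⊆ Set.Ioo (-σ) σ) (z : ℂ) :
    fourierLaplace (SchwartzMap.derivCLM ℂ ℂ φ) z =
      -(2 * Real.pi * Complex.I * z * fourierLaplace φ z) := by
  set e : ℝ → ℂ := fun ξ => Complex.exp (2 * Real.pi * Complex.I * z * ξ)
  have he : ∀ ξ : ℝ, HasDerivAt e (e ξ * (2 * Real.pi * Complex.I * z)) ξ := fun ξ => by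
    have h1 : HasDerivAt (fun x : ℂ => 2 * Real.pi * Complex.I * z * x)
        (2 * Real.pi * Complex.I * z * 1) ξ := (hasDerivAt_id (ξ : ℂ)).const_mul _
    rw [mul_one] at h1
    exact h1.cexp.comp_ofReal
  have hd : tsupport (SchwartzMap.derivCLM ℂ ℂ φ) ⊆ Set.Ioo (-σ) σ :=
    tsupport_derivCLM_subset.trans hφ
  have key := integral_mul_deriv_eq_deriv_mul_of_integrable (u := φ) (v := e)
    (u' := SchwartzMap.derivCLM ℂ ℂ φ) (v' := fun ξ => e ξ * (2 * Real.pi * Complex.I * z))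
    (fun ξ _ => by simpa using φ.hasDerivAt ξ) (fun ξ _ => he ξ)
    (integrable_mul_of_tsupport_subset_Ioo hφ (by fun_prop))
    (integrable_mul_of_tsupport_subset_Ioo hd (by fun_prop))
    (integrable_mul_of_tsupport_subset_Ioo hφ (by fun_prop))
  rw [fourierLaplace, fourierLaplace]
  simp only [e] at key
  rw [eq_neg_iff_add_eq_zero, add_comm, ← eq_neg_iff_add_eq_zero, ← key, ← integral_const_mul]
  refine integral_congr_ae (Eventually.of_forall fun ξ => ?_)
  simp only
  ring

/-- Each integration by parts trades a factor `2πz` for a derivative of `φ`. The induction is over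
all `φ` at once because its step applies the bound to `φ'`. -/
theorem exists_norm_fourierLaplace_le (N : ℕ) :
    ∀ φ : 𝓢(ℝ, ℂ), tsupport φ ⊆ Set.Ioo (-σ) σ → ∃ C : ℝ, 0 ≤ C ∧ ∀ z : ℂ,
      (1 + ‖z‖) ^ N * ‖fourierLaplace φ z‖ ≤ C * Real.exp (2 * Real.pi * σ * |z.im|) := by
  induction N with
  | zero =>
    exact fun φ hφ => ⟨∫ ξ, ‖φ ξ‖, by positivity, fun z => by simpa using norm_fourierLaplace_le hφ z⟩
  | succ N ih =>
    intro φ hφ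
    obtain ⟨C₁, h₁, hC₁⟩ := ih φ hφ
    obtain ⟨C₂, h₂, hC₂⟩ := ih (SchwartzMap.derivCLM ℂ ℂ φ) (tsupport_derivCLM_subset.trans hφ)
    refine ⟨C₁ + C₂, by positivity, fun z => ?_⟩
    have h3 : ‖z‖ * ‖fourierLaplace φ z‖ ≤ ‖fourierLaplace (SchwartzMap.derivCLM ℂ ℂ φ) z‖ := by
      rw [fourierLaplace_derivCLM hφ, norm_neg, norm_mul]
      refine mul_le_mul_of_nonneg_right ?_ (norm_nonneg _)
      simp only [norm_mul, Complex.norm_ofNat, Complex.norm_real, Complex.norm_I, mul_one,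
        Real.norm_eq_abs, abs_of_pos Real.pi_pos]
      have := Real.pi_gt_three
      nlinarith [norm_nonneg z]
    calc (1 + ‖z‖) ^ (N + 1) * ‖fourierLaplace φ z‖
        = (1 + ‖z‖) ^ N * ‖fourierLaplace φ z‖ +
          (1 + ‖z‖) ^ N * (‖z‖ * ‖fourierLaplace φ z‖) := by ring
      _ ≤ (1 + ‖z‖) ^ N * ‖fourierLaplace φ z‖ +
          (1 + ‖z‖) ^ N * ‖fourierLaplace (SchwartzMap.derivCLM ℂ ℂ φ) z‖ := by gcongr
      _ ≤ C₁ * Real.exp (2 * Real.pi * σ * |z.im|) + C₂ * Real.exp (2 * Real.pi * σ * |z.im|) :=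
        add_le_add (hC₁ z) (hC₂ z)
      _ = _ := by ring

end

/-! ### Principal values on the line. -/

theorem measurableSet_lt_abs (δ : ℝ) : MeasurableSet {τ : ℝ | δ < |τ|} :=
  (isOpen_lt continuous_const continuous_abs).measurableSet

theorem HasPrincipalValue.congr {f g : ℝ → ℂ} {I : ℂ} (hf : HasPrincipalValue f I)
    (h : ∀ τ, τ ≠ 0 → g τ = f τ) : HasPrincipalValue g I := by
  have he : ∀ δ : ℝ, 0 < δ → Set.EqOn f g {τ : ℝ | δ < |τ|} := fun δ hδ τ hτ =>
    (h τ (abs_pos.1 (hδ.trans hτ))).symm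
  refine ⟨fun δ hδ => (hf.1 δ hδ).congr_fun (he δ hδ) (measurableSet_lt_abs δ), hf.2.congr' ?_⟩
  filter_upwards [self_mem_nhdsWithin] with δ hδ
  exact setIntegral_congr_fun (measurableSet_lt_abs δ) (he δ hδ)

theorem HasPrincipalValue.principalValue_eq {f : ℝ → ℂ} {I : ℂ} (hf : HasPrincipalValue f I) :
    principalValue f = I := hf.2.limUnder_eq

theorem HasPrincipalValue.comp_mul_left {f : ℝ → ℂ} {I : ℂ} (hf : HasPrincipalValue f I) {a : ℝ}
    (ha : 0 < a) : HasPrincipalValue (fun τ => f (a * τ)) ((a : ℂ)⁻¹ * I) := by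
  have hind : ∀ δ : ℝ, Set.indicator {τ : ℝ | δ < |τ|} (fun τ => f (a * τ)) =
      fun τ => Set.indicator {t : ℝ | a * δ < |t|} f (a * τ) := by
    intro δ
    funext τ
    have : a * τ ∈ {t : ℝ | a * δ < |t|} ↔ τ ∈ {τ : ℝ | δ < |τ|} := by
      simp [abs_mul, abs_of_pos ha, ha]
    by_cases hτ : τ ∈ {τ : ℝ | δ < |τ|}
    · rw [Set.indicator_of_mem hτ, Set.indicator_of_mem (this.2 hτ)]
    · rw [Set.indicator_of_notMem hτ, Set.indicator_of_notMem (fun h => hτ (this.1 h))]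
  refine ⟨fun δ hδ => ?_, ?_⟩
  · rw [← integrable_indicator_iff (measurableSet_lt_abs δ), hind]
    exact ((integrable_indicator_iff (measurableSet_lt_abs _)).2
      (hf.1 (a * δ) (by positivity))).comp_mul_left' ha.ne'
  · have hint : ∀ δ : ℝ, ∫ τ in {τ : ℝ | δ < |τ|}, f (a * τ) =
        (a⁻¹ : ℂ) * ∫ t in {t : ℝ | a * δ < |t|}, f t := by
      intro δ
      rw [← integral_indicator (measurableSet_lt_abs δ), hind,
        Measure.integral_comp_mul_left (Set.indicator {t : ℝ | a * δ < |t|} f),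
        integral_indicator (measurableSet_lt_abs _), abs_of_pos (inv_pos.2 ha), Complex.real_smul]
      push_cast
      rfl
    simp_rw [hint]
    refine (hf.2.comp (f := fun δ : ℝ => a * δ) ?_).const_mul _
    refine tendsto_nhdsWithin_iff.2 ⟨?_, ?_⟩
    · have : Tendsto (fun δ : ℝ => a * δ) (𝓝 0) (𝓝 (a * 0)) := tendsto_id.const_mul a
      rw [mul_zero] at this
      exact this.mono_left nhdsWithin_le_nhds
    · filter_upwards [self_mem_nhdsWithin] with δ hδ
      exact mul_pos ha hδ

theorem MeasureTheory.Integrable.tendsto_setIntegral_lt_abs {f : ℝ → ℂ} (hf : Integrable f) :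
    Tendsto (fun δ : ℝ => ∫ τ in {τ : ℝ | δ < |τ|}, f τ) (𝓝[>] 0) (𝓝 (∫ τ, f τ)) := by
  have hcov : AECover volume (𝓝[>] (0 : ℝ)) fun δ : ℝ => {τ : ℝ | δ < |τ|} := by
    refine ⟨?_, fun δ => measurableSet_lt_abs δ⟩
    have h0 : ∀ᵐ τ : ℝ, τ ≠ 0 := by simp [ae_iff]
    filter_upwards [h0] with τ hτ
    exact nhdsWithin_le_nhds (gt_mem_nhds (abs_pos.2 hτ))
  exact hcov.integral_tendsto_of_countably_generated hf

theorem setIntegral_lt_abs_eq_zero_of_odd {f : ℝ → ℂ} (hf : ∀ τ, f (-τ) = -f τ) (δ : ℝ) :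
    ∫ τ in {τ : ℝ | δ < |τ|}, f τ = 0 := by
  rw [← integral_indicator (measurableSet_lt_abs δ)]
  set h := Set.indicator {τ : ℝ | δ < |τ|} f
  have hodd : ∀ τ, h (-τ) = -h τ := by
    intro τ
    simp only [h, Set.indicator, Set.mem_ofPred_eq, abs_neg, hf]
    split_ifs <;> simp
  have h1 : ∫ τ, h (-τ) = ∫ τ, h τ := integral_neg_eq_self h volume
  simp_rw [hodd, integral_neg] at h1
  exact self_eq_neg.1 h1.symm

theorem integrable_of_norm_le_div_sq {f : ℝ → ℂ} {K : ℝ} (hf : Continuous f)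
    (hK : ∀ t, 1 ≤ |t| → ‖f t‖ ≤ K / t ^ 2) : Integrable f := by
  obtain ⟨M, hM⟩ := (isCompact_Icc (a := (-1 : ℝ)) (b := 1)).exists_bound_of_continuousOn
    hf.continuousOn
  have hK0 : 0 ≤ K := by simpa using (norm_nonneg _).trans (hK 1 (by simp))
  have hM0 : 0 ≤ M := (norm_nonneg _).trans (hM 0 (by simp))
  refine (integrable_inv_one_add_sq.const_mul (2 * (K + M))).mono' hf.aestronglyMeasurable
    (Eventually.of_forall fun t => ?_)
  rw [← div_eq_mul_inv, le_div_iff₀ (by positivity)]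
  rcases le_total 1 |t| with h | h
  · have h1 : 1 ≤ t ^ 2 := by rwa [one_le_sq_iff_one_le_abs]
    have h2 := hK t h
    rw [le_div_iff₀ (by positivity)] at h2
    nlinarith [norm_nonneg (f t)]
  · have h1 : t ^ 2 ≤ 1 := by rwa [sq_le_one_iff_abs_le_one]
    have h2 := hM t (abs_le.1 h)
    nlinarith [norm_nonneg (f t)]

/-! ### Contour shifts in a vertical strip. -/

section Strip

variable {D : ℂ → ℂ} {c K : ℝ} {V : Set ℂ}

theorem integrable_vertical (hV : IsOpen V) (hsub : ∀ w : ℂ, 0 ≤ w.re → w.re ≤ c → w ∈ V)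
    (hD : DifferentiableOn ℂ D V)
    (hK : ∀ w : ℂ, 0 ≤ w.re → w.re ≤ c → 1 ≤ |w.im| → ‖D w‖ ≤ K / w.im ^ 2) {x : ℝ} (hx : 0 ≤ x)
    (hxc : x ≤ c) : Integrable fun t : ℝ => D (x + t * Complex.I) := by
  refine integrable_of_norm_le_div_sq (K := K) ?_ fun t ht => ?_
  · refine continuous_iff_continuousAt.2 fun t => ?_
    have h1 : ContinuousAt D (x + t * Complex.I) :=
      (hD.differentiableAt (hV.mem_nhds (hsub _ (by simpa using hx) (by simpa using hxc)))).continuousAt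
    exact ContinuousAt.comp (f := fun t : ℝ => (x : ℂ) + t * Complex.I) h1 (by fun_prop)
  · simpa using hK (x + t * Complex.I) (by simpa using hx) (by simpa using hxc) (by simpa using ht)

/-- Cauchy's theorem on rectangles of height `2T`; the horizontal sides contribute `O(T ^ (-2))`. -/
theorem integral_vertical_eq (hc : 0 ≤ c) (hV : IsOpen V)
    (hsub : ∀ w : ℂ, 0 ≤ w.re → w.re ≤ c → w ∈ V) (hD : DifferentiableOn ℂ D V)
    (hK : ∀ w : ℂ, 0 ≤ w.re → w.re ≤ c → 1 ≤ |w.im| → ‖D w‖ ≤ K / w.im ^ 2) :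
    ∫ t : ℝ, D (t * Complex.I) = ∫ t : ℝ, D (c + t * Complex.I) := by
  have hi0 := integrable_vertical hV hsub hD hK le_rfl hc
  have hic := integrable_vertical hV hsub hD hK hc le_rfl
  simp only [Complex.ofReal_zero, zero_add] at hi0
  have hn : Tendsto (fun T : ℝ => -T) atTop atBot := tendsto_neg_atTop_atBot
  have l0 := intervalIntegral_tendsto_integral hi0 hn tendsto_id
  have lc := intervalIntegral_tendsto_integral hic hn tendsto_id
  have hh : ∀ ε : ℝ, |ε| = 1 → Tendsto (fun T : ℝ => ∫ x in (0 : ℝ)..c, D (x + (ε * T : ℝ) * Complex.I))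
      atTop (𝓝 0) := by
    intro ε hε
    have hlim : Tendsto (fun T : ℝ => K / T ^ 2 * |c - 0|) atTop (𝓝 0) := by
      have : Tendsto (fun T : ℝ => K / T ^ 2) atTop (𝓝 0) :=
        tendsto_const_nhds.div_atTop (tendsto_pow_atTop two_ne_zero)
      simpa using this.mul_const |c - 0|
    refine squeeze_zero_norm' ?_ hlim
    filter_upwards [eventually_ge_atTop 1] with T hT
    refine intervalIntegral.norm_integral_le_of_norm_le_const fun x hx => ?_
    rw [Set.uIoc_of_le hc] at hx
    have := hK (x + (ε * T : ℝ) * Complex.I) (by simpa using hx.1.le) (by simpa using hx.2)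
      (by simp [abs_mul, hε]; exact hT.trans (le_abs_self T))
    have h2 : ε ^ 2 = 1 := by rw [← sq_abs, hε, one_pow]
    simpa [mul_pow, h2] using this
  have hrect : ∀ T : ℝ, (∫ t in -T..T, D (c + t * Complex.I)) - (∫ t in -T..T, D (t * Complex.I)) =
      Complex.I * ((∫ x in (0 : ℝ)..c, D (x + ((-1) * T : ℝ) * Complex.I)) -
        ∫ x in (0 : ℝ)..c, D (x + (1 * T : ℝ) * Complex.I)) := by
    intro T
    have := Complex.integral_boundary_rect_eq_zero_of_differentiableOn D
      (-T * Complex.I) (c + T * Complex.I) (hD.mono fun w hw => by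
        have h := hw.1
        simp only [Set.mem_preimage] at h
        simp [Set.uIcc_of_le hc] at h
        exact hsub w h.1 h.2)
    simp only [smul_eq_mul] at this
    simp at this
    simp only [one_mul, Complex.ofReal_neg, neg_mul]
    linear_combination (-Complex.I) * this + ((∫ t in -T..T, D (c + t * Complex.I)) -
      ∫ t in -T..T, D (t * Complex.I)) * Complex.I_sq
  have h1 := lc.sub l0
  have h2 : Tendsto (fun T : ℝ => Complex.I *
      ((∫ x in (0 : ℝ)..c, D (x + ((-1) * T : ℝ) * Complex.I)) -
        ∫ x in (0 : ℝ)..c, D (x + (1 * T : ℝ) * Complex.I))) atTop (𝓝 (Complex.I * (0 - 0))) :=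
    ((hh (-1) (by simp)).sub (hh 1 (by simp))).const_mul _
  have h3 := tendsto_nhds_unique (h1.congr fun T => hrect T) h2
  rw [sub_zero, mul_zero, sub_eq_zero] at h3
  exact h3.symm

end Strip

/-- The integrand has the primitive `log (w / (1 + w))` up to a factor `i`, and this tends to `0` at
both ends of the line `Re w = c`. -/
theorem integral_vertical_inv_mul_one_add {c : ℝ} (hc : 0 < c) :
    Integrable (fun t : ℝ => (((c : ℂ) + t * Complex.I) * (1 + (c + t * Complex.I)))⁻¹) ∧
    ∫ t : ℝ, (((c : ℂ) + t * Complex.I) * (1 + (c + t * Complex.I)))⁻¹ = 0 := by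
  have hw : ∀ t : ℝ, (c : ℂ) + t * Complex.I ≠ 0 := fun t h => by
    have := congrArg Complex.re h; simp at this; exact hc.ne' this
  have hw1 : ∀ t : ℝ, 1 + ((c : ℂ) + t * Complex.I) ≠ 0 := fun t h => by
    have := congrArg Complex.re h; simp at this; linarith
  have hint : Integrable
      (fun t : ℝ => (((c : ℂ) + t * Complex.I) * (1 + (c + t * Complex.I)))⁻¹) := by
    refine integrable_of_norm_le_div_sq (K := 1) ?_ fun t ht => ?_
    · exact Continuous.inv₀ (by fun_prop) fun t => mul_ne_zero (hw t) (hw1 t)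
    · rw [norm_inv, norm_mul, one_div]
      have h1 : |t| ≤ ‖(c : ℂ) + t * Complex.I‖ := by
        simpa using Complex.abs_im_le_norm ((c : ℂ) + t * Complex.I)
      have h2 : |t| ≤ ‖1 + ((c : ℂ) + t * Complex.I)‖ := by
        simpa using Complex.abs_im_le_norm (1 + ((c : ℂ) + t * Complex.I))
      rw [← sq_abs, sq]
      gcongr
  refine ⟨hint, ?_⟩
  set F : ℝ → ℂ := fun t => Complex.log (1 - (1 + ((c : ℂ) + t * Complex.I))⁻¹)
  have hF : ∀ t : ℝ, HasDerivAt F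
      (Complex.I * (((c : ℂ) + t * Complex.I) * (1 + (c + t * Complex.I)))⁻¹) t := by
    intro t
    have h1 : HasDerivAt (fun z : ℂ => 1 + ((c : ℂ) + z * Complex.I)) (1 * Complex.I) (t : ℂ) :=
      (((hasDerivAt_id _).mul_const _).const_add _).const_add _
    have h2 := (h1.inv (hw1 t)).const_sub 1
    have hslit : 1 - (1 + ((c : ℂ) + t * Complex.I))⁻¹ ∈ Complex.slitPlane := by
      left
      have h3 : ‖(1 + ((c : ℂ) + t * Complex.I))⁻¹‖ < 1 := by
        rw [norm_inv]
        refine inv_lt_one_of_one_lt₀ ?_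
        refine lt_of_lt_of_le ?_ (Complex.re_le_norm _)
        simpa using hc
      have := (Complex.re_le_norm _).trans_lt h3
      rw [Complex.sub_re, Complex.one_re]
      linarith
    refine (h2.clog hslit).comp_ofReal.congr_deriv ?_
    have e : 1 - (1 + ((c : ℂ) + t * Complex.I))⁻¹ =
        ((c : ℂ) + t * Complex.I) / (1 + ((c : ℂ) + t * Complex.I)) := by
      rw [eq_div_iff (hw1 t), sub_mul, inv_mul_cancel₀ (hw1 t)]; ring
    simp only [Pi.inv_apply]
    rw [e]
    have := hw t
    have := hw1 t
    field_simp
  have hlim : ∀ l : Filter ℝ, Tendsto (fun t : ℝ => |t|) l atTop → Tendsto F l (𝓝 0) := by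
    intro l hl
    have h1 : Tendsto (fun t : ℝ => (1 + ((c : ℂ) + t * Complex.I))⁻¹) l (𝓝 0) := by
      refine tendsto_inv₀_cobounded.comp (tendsto_norm_atTop_iff_cobounded.1 ?_)
      refine tendsto_atTop_mono (fun t => ?_) hl
      simpa using Complex.abs_im_le_norm (1 + ((c : ℂ) + t * Complex.I))
    have h2 := h1.const_sub 1
    rw [sub_zero] at h2
    have h3 := (continuousAt_clog (x := 1) (by simp)).tendsto.comp h2
    rw [Complex.log_one] at h3
    exact h3
  have := integral_of_hasDerivAt_of_tendsto hF (hint.const_mul _)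
    (hlim _ tendsto_abs_atBot_atTop) (hlim _ tendsto_abs_atTop_atTop)
  rw [integral_const_mul, sub_zero] at this
  simpa using this

/-- Shifting the contour of a principal value integral to the right, past a simple pole. -/
theorem hasPrincipalValue_of_strip {E : ℂ → ℂ} {c C : ℝ} {U : Set ℂ} (hc : 0 < c) (hU : IsOpen U)
    (hsub : ∀ w : ℂ, 0 ≤ w.re → w.re ≤ c → w ∈ U) (hE : DifferentiableOn ℂ E U)
    (hC : ∀ w : ℂ, 0 ≤ w.re → w.re ≤ c → ‖E w‖ ≤ C / (1 + ‖w‖) ^ 2) :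
    HasPrincipalValue (fun t : ℝ => E (t * Complex.I) / (t * Complex.I))
      ((∫ t : ℝ, E (c + t * Complex.I) / (c + t * Complex.I)) - Real.pi * E 0) := by
  -- Subtracting `E 0 / (1 + w)` removes the pole of `E w / w` at `0` and keeps quadratic decay at
  -- infinity, so `D = E₁ / w` can be moved by Cauchy's theorem. The correction integrates to `0`
  -- over `Re w = c`.
  set E₁ : ℂ → ℂ := fun w => E w - E 0 / (1 + w)
  set D : ℂ → ℂ := dslope E₁ 0
  set V : Set ℂ := U ∩ {w | -1 < w.re}
  have hV : IsOpen V := hU.inter (isOpen_lt continuous_const Complex.continuous_re)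
  have hsubV : ∀ w : ℂ, 0 ≤ w.re → w.re ≤ c → w ∈ V := fun w h1 h2 =>
    ⟨hsub w h1 h2, by simp only [Set.mem_ofPred_eq]; linarith⟩
  have h1w : ∀ w : ℂ, -1 < w.re → 1 + w ≠ 0 := fun w hw h => by
    have := congrArg Complex.re h; simp at this; linarith
  have hE₁ : DifferentiableOn ℂ E₁ V := by
    refine (hE.mono Set.inter_subset_left).sub ?_
    exact DifferentiableOn.div (by fun_prop) (by fun_prop) fun w hw => h1w w hw.2
  have hDV : DifferentiableOn ℂ D V :=
    (Complex.differentiableOn_dslope (hV.mem_nhds (hsubV 0 (by simp) (by simpa using hc.le)))).2 hE₁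
  have hE₁0 : E₁ 0 = 0 := by simp [E₁]
  have hDw : ∀ w : ℂ, w ≠ 0 → -1 < w.re → D w = E w / w - E 0 * (w * (1 + w))⁻¹ := by
    intro w hw hw1
    have := h1w w hw1
    rw [show D w = dslope E₁ 0 w from rfl, dslope_of_ne _ hw, slope_def_field, hE₁0]
    simp only [E₁]
    field_simp
    ring
  have hC0 : 0 ≤ C := by simpa using (norm_nonneg _).trans (hC 0 (by simp) (by simpa using hc.le))
  have hK : ∀ w : ℂ, 0 ≤ w.re → w.re ≤ c → 1 ≤ |w.im| → ‖D w‖ ≤ (C + ‖E 0‖) / w.im ^ 2 := by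
    intro w h1 h2 h3
    have hw : |w.im| ≤ ‖w‖ := Complex.abs_im_le_norm w
    have hw' : |w.im| ≤ ‖1 + w‖ := by simpa using Complex.abs_im_le_norm (1 + w)
    have hwn : 0 < ‖w‖ := by linarith
    rw [hDw w (norm_pos_iff.1 hwn) (by linarith), add_div]
    refine (norm_sub_le _ _).trans (add_le_add ?_ ?_)
    · rw [norm_div, ← sq_abs]
      calc ‖E w‖ / ‖w‖ ≤ C / (1 + ‖w‖) ^ 2 / 1 := by
            have := hC w h1 h2
            gcongr
            linarith
        _ ≤ C / |w.im| ^ 2 := by rw [div_one]; gcongr; linarith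
    · rw [norm_mul, norm_inv, norm_mul, ← div_eq_mul_inv, ← sq_abs, sq]
      gcongr
  have hD0 := integrable_vertical hV hsubV hDV hK le_rfl hc.le
  simp only [Complex.ofReal_zero, zero_add] at hD0
  have hshift := integral_vertical_eq hc.le hV hsubV hDV hK
  obtain ⟨hG, hG0⟩ := integral_vertical_inv_mul_one_add hc
  have hDc := integrable_vertical hV hsubV hDV hK hc.le le_rfl
  have hEc : (∫ t : ℝ, D (c + t * Complex.I)) =
      ∫ t : ℝ, E (c + t * Complex.I) / (c + t * Complex.I) := by
    have h1 : ∀ t : ℝ, E (c + t * Complex.I) / (c + t * Complex.I) = D (c + t * Complex.I) +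
        E 0 * (((c : ℂ) + t * Complex.I) * (1 + (c + t * Complex.I)))⁻¹ := by
      intro t
      rw [hDw]
      · ring
      · intro h
        have := congrArg Complex.re h; simp at this; linarith
      · simp; linarith
    simp_rw [h1]
    rw [integral_add hDc (hG.const_mul _), integral_const_mul, hG0, mul_zero, add_zero]
  have hcauchy : Integrable fun t : ℝ => (((1 + t ^ 2)⁻¹ : ℝ) : ℂ) :=
    integrable_inv_one_add_sq.ofReal
  -- On the imaginary axis `1 / (w (1 + w))` splits into an odd singular part, with principal value
  -- `0`, and `-1 / (1 + t²)`, whose integral `-π` is the half residue.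
  set O : ℝ → ℂ := fun t => E 0 * (-Complex.I * ((t * (1 + t ^ 2))⁻¹ : ℝ))
  set H : ℝ → ℂ := fun t => D (t * Complex.I) - E 0 * (((1 + t ^ 2)⁻¹ : ℝ) : ℂ)
  have hH : Integrable H := hD0.sub (hcauchy.const_mul _)
  have hOint : ∀ δ : ℝ, 0 < δ → IntegrableOn O {τ : ℝ | δ < |τ|} := by
    intro δ hδ
    suffices h : IntegrableOn (fun t : ℝ => (t * (1 + t ^ 2))⁻¹) {τ : ℝ | δ < |τ|} from
      (h.ofReal.const_mul _).const_mul _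
    refine ((integrable_inv_one_add_sq.const_mul δ⁻¹).integrableOn).mono'
      (Measurable.aestronglyMeasurable (by fun_prop)) ?_
    rw [ae_restrict_iff' (measurableSet_lt_abs δ)]
    refine Eventually.of_forall fun t ht => ?_
    have ht' : δ < |t| := ht
    rw [norm_inv, norm_mul, mul_inv, Real.norm_eq_abs, Real.norm_of_nonneg (by positivity)]
    gcongr
  have hO0 : ∀ δ : ℝ, ∫ τ in {τ : ℝ | δ < |τ|}, O τ = 0 :=
    setIntegral_lt_abs_eq_zero_of_odd fun t => by
      simp only [O]
      rw [neg_sq, neg_mul t, inv_neg]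
      push_cast
      ring
  have hHO : HasPrincipalValue (fun t => H t + O t) (∫ t, H t) := by
    refine ⟨fun δ hδ => hH.integrableOn.add (hOint δ hδ), ?_⟩
    refine hH.tendsto_setIntegral_lt_abs.congr' ?_
    filter_upwards [self_mem_nhdsWithin] with δ hδ
    rw [integral_add hH.integrableOn (hOint δ hδ), hO0, add_zero]
  have hval : ∫ t, H t =
      (∫ t : ℝ, E (c + t * Complex.I) / (c + t * Complex.I)) - Real.pi * E 0 := by
    rw [integral_sub hD0 (hcauchy.const_mul _), hshift, hEc, integral_const_mul, integral_complex_ofReal,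
      integral_univ_inv_one_add_sq, mul_comm]
  rw [← hval]
  refine hHO.congr fun t ht => ?_
  have htc : (t : ℂ) ≠ 0 := by exact_mod_cast ht
  have h1 : 1 + (t : ℂ) * Complex.I ≠ 0 := h1w _ (by simp)
  have h2 : 1 + (t : ℂ) ^ 2 ≠ 0 := by exact_mod_cast (by positivity : 1 + t ^ 2 ≠ 0)
  simp only [H, O]
  rw [hDw _ (mul_ne_zero htc Complex.I_ne_zero) (by simp)]
  have h3 : ((t : ℂ) * Complex.I * (1 + t * Complex.I))⁻¹ =
      -Complex.I * (t * (1 + (t : ℂ) ^ 2))⁻¹ - (1 + (t : ℂ) ^ 2)⁻¹ := by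
    field_simp
    linear_combination (1 + t * Complex.I + (t : ℂ) ^ 2) * Complex.I_sq
  rw [h3]
  push_cast
  ring

/-! ### Counting discriminants and summing powers over them. -/

/-- As `4` is invertible modulo `k²`, the condition confines `m` to one residue class. -/
theorem card_filter_sq_dvd_le {k : ℕ} (hk : Odd k) (M : ℕ) :
    (((Finset.range M).filter fun m => k ^ 2 ∣ 4 * m + 1).card : ℝ) ≤ M * ((k : ℝ) ^ 2)⁻¹ + 1 := by
  have hk0 : 0 < k ^ 2 := pow_pos hk.pos 2
  rcases Finset.eq_empty_or_nonempty ((Finset.range M).filter fun m => k ^ 2 ∣ 4 * m + 1)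
    with h | ⟨m₀, hm₀⟩
  · rw [h]; simp; positivity
  have hd₀ := (Finset.mem_filter.1 hm₀).2
  have hcop : Nat.Coprime (k ^ 2) 4 := by
    rw [show 4 = 2 ^ 2 by norm_num]
    exact (Nat.coprime_two_right.2 hk).pow 2 2
  have hsub : ((Finset.range M).filter fun m => k ^ 2 ∣ 4 * m + 1) ⊆
      (Finset.range M).filter fun m => m ≡ m₀ [MOD k ^ 2] := by
    intro m hm
    rw [Finset.mem_filter] at hm ⊢
    refine ⟨hm.1, ?_⟩
    have h1 : 4 * m + 1 ≡ 4 * m₀ + 1 [MOD k ^ 2] :=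
      ((Nat.modEq_zero_iff_dvd.2 hm.2).trans (Nat.modEq_zero_iff_dvd.2 hd₀).symm)
    exact Nat.ModEq.cancel_left_of_coprime hcop (Nat.ModEq.add_right_cancel' 1 h1)
  have h1 := Finset.card_le_card hsub
  rw [← Nat.count_eq_card_filter_range fun m => m ≡ m₀ [MOD k ^ 2],
    Nat.count_modEq_card _ hk0] at h1
  have h2 : M / k ^ 2 + (if m₀ % k ^ 2 < M % k ^ 2 then 1 else 0) ≤ M / k ^ 2 + 1 := by
    gcongr; split_ifs <;> norm_num
  have h3 : ((M / k ^ 2 : ℕ) : ℝ) ≤ M * ((k : ℝ) ^ 2)⁻¹ := by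
    refine Nat.cast_div_le.trans (le_of_eq ?_)
    push_cast
    rw [div_eq_mul_inv]
  have h4 : (((Finset.range M).filter fun m => k ^ 2 ∣ 4 * m + 1).card : ℝ) ≤
      ((M / k ^ 2 : ℕ) : ℝ) + 1 := by exact_mod_cast h1.trans h2
  linarith

/-- A union bound suffices: square divisors of `4m + 1` other than `1` come from odd `k ≥ 3`, and
`∑_{k ≥ 3} k ^ (-2) ≤ 1/2` already leaves a positive proportion. -/
theorem le_card_filter_squarefree (M : ℕ) :
    (M : ℝ) / 2 - 2 * √M ≤ ((Finset.range M).filter fun m => Squarefree (4 * m + 1)).card := by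
  set K := Nat.sqrt (4 * M)
  have hcover : (Finset.range M).filter (fun m => ¬ Squarefree (4 * m + 1)) ⊆
      ((Finset.Ioc 2 K).filter Odd).biUnion
        fun k => (Finset.range M).filter fun m => k ^ 2 ∣ 4 * m + 1 := by
    intro m hm
    obtain ⟨hmM, hns⟩ := Finset.mem_filter.1 hm
    rw [Squarefree] at hns
    push Not at hns
    obtain ⟨k, hkd, hku⟩ := hns
    have hodd : Odd k := by
      have : Odd (k * k) := Odd.of_dvd_nat ⟨2 * m, by ring⟩ hkd
      exact (Nat.odd_mul.1 this).1
    have hk1 : k ≠ 1 := fun h => hku (by simp [h])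
    have hk2 : 2 < k := by
      obtain ⟨j, rfl⟩ := hodd
      omega
    have hkK : k ≤ K := by
      rw [Nat.le_sqrt]
      have := Nat.le_of_dvd (by omega) hkd
      have := Finset.mem_range.1 hmM
      omega
    simp only [Finset.mem_biUnion, Finset.mem_filter, Finset.mem_Ioc]
    exact ⟨k, ⟨⟨hk2, hkK⟩, hodd⟩, hmM, by rwa [sq]⟩
  have hbad : (((Finset.range M).filter (fun m => ¬ Squarefree (4 * m + 1))).card : ℝ) ≤
      M / 2 + K := by
    calc (((Finset.range M).filter (fun m => ¬ Squarefree (4 * m + 1))).card : ℝ)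
        ≤ ∑ k ∈ (Finset.Ioc 2 K).filter Odd,
          (((Finset.range M).filter fun m => k ^ 2 ∣ 4 * m + 1).card : ℝ) := by
          exact_mod_cast (Finset.card_le_card hcover).trans Finset.card_biUnion_le
      _ ≤ ∑ k ∈ (Finset.Ioc 2 K).filter Odd, (M * ((k : ℝ) ^ 2)⁻¹ + 1) :=
          Finset.sum_le_sum fun k hk => card_filter_sq_dvd_le (Finset.mem_filter.1 hk).2 M
      _ ≤ ∑ k ∈ Finset.Ioc 2 K, (M * ((k : ℝ) ^ 2)⁻¹ + 1) :=
          Finset.sum_le_sum_of_subset_of_nonneg (Finset.filter_subset _ _)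
            fun k _ _ => by positivity
      _ = M * ∑ k ∈ Finset.Ioc 2 K, ((k : ℝ) ^ 2)⁻¹ + ((K - 2 : ℕ) : ℝ) := by
          rw [Finset.sum_add_distrib, Finset.mul_sum]; simp
      _ ≤ M * (1 / 2) + K := by
          have h1 : ∑ k ∈ Finset.Ioc 2 K, ((k : ℝ) ^ 2)⁻¹ ≤ 1 / 2 := by
            rcases le_total 2 K with h | h
            · refine (sum_Ioc_inv_sq_le_sub two_ne_zero h).trans ?_
              have : (0 : ℝ) ≤ (K : ℝ)⁻¹ := by positivity
              push_cast
              linarith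
            · rw [Finset.Ioc_eq_empty (by omega)]; simp
          have h2 : ((K - 2 : ℕ) : ℝ) ≤ K := by exact_mod_cast Nat.sub_le _ _
          gcongr
      _ = M / 2 + K := by ring
  have hK : (K : ℝ) ≤ 2 * √M := by
    have h1 : (K : ℝ) ≤ √((4 * M : ℕ) : ℝ) := Real.nat_sqrt_le_real_sqrt
    refine h1.trans (le_of_eq ?_)
    push_cast
    rw [Real.sqrt_mul (by norm_num), show (4 : ℝ) = 2 ^ 2 by norm_num,
      Real.sqrt_sq (by norm_num)]
  have htot : ((((Finset.range M).filter fun m => Squarefree (4 * m + 1)).card : ℝ)) +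
      (((Finset.range M).filter (fun m => ¬ Squarefree (4 * m + 1))).card : ℝ) = M := by
    have := Finset.card_filter_add_card_filter_not (s := Finset.range M)
      (fun m => Squarefree (4 * m + 1))
    rw [Finset.card_range] at this
    exact_mod_cast this
  linarith

theorem le_card_evenFundDiscr {X : ℝ} (hX : 300 ≤ X) : X / 32 ≤ (evenFundDiscr X).card := by
  set M := ⌊X / 4⌋₊
  have hM1 : (M : ℝ) ≤ X / 4 := Nat.floor_le (by linarith)
  have hM2 : X / 4 < M + 1 := Nat.lt_floor_add_one _
  have hinj : ((Finset.range M).filter fun m => Squarefree (4 * m + 1)).card ≤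
      (evenFundDiscr X).card := by
    refine Finset.card_le_card_of_injOn (fun m : ℕ => (4 * m + 1 : ℤ)) ?_ ?_
    · intro m hm
      obtain ⟨h1, h2⟩ := Finset.mem_filter.1 hm
      have h1' : (m : ℝ) + 1 ≤ M := by exact_mod_cast Finset.mem_range.1 h1
      simp only [evenFundDiscr, Finset.coe_filter, Finset.mem_Ioc, Set.mem_ofPred_eq]
      refine ⟨⟨by positivity, Int.le_floor.2 ?_⟩, Or.inl ⟨?_, by omega⟩⟩
      · push_cast; linarith
      · exact_mod_cast Int.squarefree_natCast.2 h2
    · intro a _ b _ h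
      simp only at h
      omega
  have h1 := le_card_filter_squarefree M
  have h2 : (((Finset.range M).filter fun m => Squarefree (4 * m + 1)).card : ℝ) ≤
      (evenFundDiscr X).card := by exact_mod_cast hinj
  have h3 : 8 ≤ √(M : ℝ) := by
    refine Real.le_sqrt_of_sq_le ?_
    rw [show (8 : ℝ) ^ 2 = 64 by norm_num]
    linarith
  have h4 := Real.sq_sqrt (Nat.cast_nonneg (α := ℝ) M)
  nlinarith

theorem sum_range_rpow_neg_le {c : ℝ} (hc0 : 0 ≤ c) (hc1 : c < 1) (N : ℕ) :
    ∑ n ∈ Finset.range N, ((n : ℝ) + 1) ^ (-c) ≤ (N : ℝ) ^ (1 - c) / (1 - c) := by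
  induction N with
  | zero => simp [Real.zero_rpow (by linarith : 1 - c ≠ 0)]
  | succ N ih =>
    rw [Finset.sum_range_succ]
    have hp : (0 : ℝ) < (N : ℝ) + 1 := by positivity
    have h1c : 0 < 1 - c := by linarith
    -- Bernoulli's inequality for the exponent `1 - c ≤ 1` replaces comparison with `∫ x ^ (-c)`:
    -- one step of `N ^ (1 - c) / (1 - c)` is at least `(N + 1) ^ (-c)`.
    have hb := rpow_one_add_le_one_add_mul_self (s := -(1 / ((N : ℝ) + 1))) (p := 1 - c)
      (by
        have : 1 / ((N : ℝ) + 1) ≤ 1 := by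
          rw [div_le_one hp]; linarith [N.cast_nonneg (α := ℝ)]
        linarith) h1c.le (by linarith)
    have hN : (N : ℝ) = ((N : ℝ) + 1) * (1 + -(1 / ((N : ℝ) + 1))) := by field_simp; ring
    have h0 : 0 ≤ 1 + -(1 / ((N : ℝ) + 1)) := by
      by_contra h
      push Not at h
      have := mul_neg_of_pos_of_neg hp h
      rw [← hN] at this
      linarith [N.cast_nonneg (α := ℝ)]
    have h2 : (N : ℝ) ^ (1 - c) ≤ ((N : ℝ) + 1) ^ (1 - c) - (1 - c) * ((N : ℝ) + 1) ^ (-c) := by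
      calc (N : ℝ) ^ (1 - c) = ((N : ℝ) + 1) ^ (1 - c) * (1 + -(1 / ((N : ℝ) + 1))) ^ (1 - c) := by
            rw [← Real.mul_rpow hp.le h0, ← hN]
        _ ≤ ((N : ℝ) + 1) ^ (1 - c) * (1 + (1 - c) * -(1 / ((N : ℝ) + 1))) := by gcongr
        _ = _ := by
          rw [show ((N : ℝ) + 1) ^ (1 - c) = ((N : ℝ) + 1) * ((N : ℝ) + 1) ^ (-c) by
            rw [sub_eq_add_neg, Real.rpow_add hp, Real.rpow_one]]
          field_simp
          ring
    rw [le_div_iff₀ h1c] at ih ⊢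
    push_cast
    nlinarith

theorem sum_evenFundDiscr_rpow_neg_le {c : ℝ} (hc0 : 0 ≤ c) (hc1 : c < 1) {X : ℝ} (hX : 0 ≤ X) :
    ∑ d ∈ evenFundDiscr X, (d : ℝ) ^ (-c) ≤ X ^ (1 - c) / (1 - c) := by
  have hsub : evenFundDiscr X ⊆ (Finset.range ⌊X⌋₊).image fun n : ℕ => (n + 1 : ℤ) := by
    intro d hd
    simp only [evenFundDiscr, Finset.mem_filter, Finset.mem_Ioc] at hd
    have h := hd.1
    rw [Finset.mem_image]
    refine ⟨(d - 1).toNat, ?_, by omega⟩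
    rw [Finset.mem_range]
    have : (⌊X⌋₊ : ℤ) = ⌊X⌋ := Int.natCast_floor_eq_floor hX
    omega
  calc ∑ d ∈ evenFundDiscr X, (d : ℝ) ^ (-c)
      ≤ ∑ d ∈ (Finset.range ⌊X⌋₊).image fun n : ℕ => (n + 1 : ℤ), (d : ℝ) ^ (-c) := by
        refine Finset.sum_le_sum_of_subset_of_nonneg hsub fun d hd _ => ?_
        obtain ⟨n, _, rfl⟩ := Finset.mem_image.1 hd
        positivity
    _ = ∑ n ∈ Finset.range ⌊X⌋₊, ((n : ℝ) + 1) ^ (-c) := by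
        rw [Finset.sum_image fun a _ b _ h => by simpa using h]
        push_cast
        rfl
    _ ≤ (⌊X⌋₊ : ℝ) ^ (1 - c) / (1 - c) := sum_range_rpow_neg_le hc0 hc1 _
    _ ≤ X ^ (1 - c) / (1 - c) := by
        have := Nat.floor_le hX
        have h1 : 0 ≤ 1 - c := by linarith
        gcongr

/-! ### The integrand as a function of `w`, and its shifted integral. -/

/-- The factor of the integrand of `R(g; X)` that depends neither on `g` nor on `d`, multiplied by
`w` to remove the pole at the origin. -/
noncomputable def ratiosKernel (w : ℂ) : ℂ :=
  -2 * riemannZeta 2 * (Complex.Gamma (5 / 4 - w / 2) / Complex.Gamma (1 / 4 + w / 2)) *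
    (zetaReg (1 - 2 * w) / zetaReg (2 - 2 * w))

theorem isOpen_re_strip (a b : ℝ) : IsOpen {w : ℂ | a < w.re ∧ w.re < b} :=
  (isOpen_lt continuous_const Complex.continuous_re).inter
    (isOpen_lt Complex.continuous_re continuous_const)

theorem differentiableOn_ratiosKernel (hRH : RiemannHypothesis) :
    DifferentiableOn ℂ ratiosKernel {w : ℂ | -1 / 2 < w.re ∧ w.re < 3 / 4} := by
  have hG : ∀ s : ℂ, 0 < s.re → DifferentiableAt ℂ Complex.Gamma s := fun s hs =>
    Complex.differentiableAt_Gamma s fun m h => by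
      rw [h] at hs
      simp at hs
      linarith [m.cast_nonneg (α := ℝ)]
  intro w hw
  obtain ⟨h1, h2⟩ := hw
  refine DifferentiableAt.differentiableWithinAt ?_
  unfold ratiosKernel
  have hre1 : 0 < (5 / 4 - w / 2 : ℂ).re := by simp; linarith
  have hre2 : 0 < (1 / 4 + w / 2 : ℂ).re := by simp; linarith
  refine DifferentiableAt.mul (DifferentiableAt.const_mul (DifferentiableAt.div ?_ ?_ ?_) _)
    (DifferentiableAt.div ?_ ?_ ?_)
  · exact DifferentiableAt.comp (f := fun w : ℂ => 5 / 4 - w / 2) w (hG _ hre1) (by fun_prop)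
  · exact DifferentiableAt.comp (f := fun w : ℂ => 1 / 4 + w / 2) w (hG _ hre2) (by fun_prop)
  · exact Complex.Gamma_ne_zero_of_re_pos hre2
  · exact DifferentiableAt.comp (f := fun w : ℂ => 1 - 2 * w) w (differentiable_zetaReg _)
      (by fun_prop)
  · exact DifferentiableAt.comp (f := fun w : ℂ => 2 - 2 * w) w (differentiable_zetaReg _)
      (by fun_prop)
  · exact zetaReg_ne_zero hRH (by simp; linarith)

theorem ratiosKernel_zero : ratiosKernel 0 = -1 / 2 := by
  have h1 : Complex.Gamma (5 / 4) = 1 / 4 * Complex.Gamma (1 / 4) := by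
    rw [← Complex.Gamma_add_one _ (by norm_num)]; norm_num
  have h2 : Complex.Gamma (1 / 4) ≠ 0 := Complex.Gamma_ne_zero_of_re_pos (by norm_num)
  have h3 : riemannZeta 2 ≠ 0 := riemannZeta_ne_zero_of_one_lt_re (by norm_num)
  have h4 : zetaReg 2 = riemannZeta 2 := by
    rw [zetaReg_of_ne (by norm_num)]; norm_num
  simp only [ratiosKernel, zero_div, mul_zero, sub_zero, add_zero, zetaReg_one, h1, h4]
  field_simp
  norm_num

theorem exists_norm_ratiosKernel_le (hRH : RiemannHypothesis) {c : ℝ} (hc : c < 3 / 4) :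
    ∃ (C : ℝ) (A : ℕ), 0 ≤ C ∧ ∀ w : ℂ, 0 ≤ w.re → w.re ≤ c →
      ‖ratiosKernel w‖ ≤ C * (1 + ‖w‖) ^ A := by
  obtain ⟨C₁, h₁, hC₁⟩ := exists_norm_Gamma_div_Gamma_le
  obtain ⟨C₂, h₂, hC₂⟩ := exists_norm_zetaReg_le
  -- `Re (2 - 2w) ≥ 2 - 2c = 1/2 + δ`, and `δ > 0` is exactly `c < 3/4`.
  obtain ⟨C₃, A, h₃, hC₃⟩ := exists_le_norm_zetaReg hRH (δ := 3 / 2 - 2 * c) (by linarith)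
  refine ⟨2 * ‖riemannZeta 2‖ * C₁ * (C₂ * 2 ^ 3) * (C₃ * 3 ^ A), 1 + 3 + A, by positivity,
    fun w hw0 hwc => ?_⟩
  have hre : (2 - 2 * w).re = 2 - 2 * w.re := by simp
  have e1 := hC₁ w hw0 (by linarith)
  have e2 : ‖zetaReg (1 - 2 * w)‖ ≤ C₂ * (2 * (1 + ‖w‖)) ^ 3 := by
    refine (hC₂ _ (by simp; linarith)).trans ?_
    have : ‖1 - 2 * w‖ ≤ 1 + 2 * ‖w‖ := (norm_sub_le _ _).trans (by simp)
    gcongr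
    linarith
  have e3 : ‖zetaReg (2 - 2 * w)‖⁻¹ ≤ C₃ * (3 * (1 + ‖w‖)) ^ A := by
    have h := hC₃ (2 - 2 * w) (by rw [hre]; linarith) (by rw [hre]; linarith)
    have hpos : 0 < ‖zetaReg (2 - 2 * w)‖ :=
      norm_pos_iff.2 (zetaReg_ne_zero hRH (by rw [hre]; linarith))
    rw [inv_le_iff_one_le_mul₀ hpos]
    refine h.trans ?_
    have : ‖2 - 2 * w‖ ≤ 2 + 2 * ‖w‖ := (norm_sub_le _ _).trans (by simp)
    gcongr
    linarith [norm_nonneg w]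
  rw [ratiosKernel, norm_mul, norm_mul, norm_mul, norm_div (zetaReg _),
    div_eq_mul_inv ‖zetaReg _‖, norm_neg,
    Complex.norm_ofNat]
  calc _ ≤ 2 * ‖riemannZeta 2‖ * (C₁ * (1 + ‖w‖)) *
        (C₂ * (2 * (1 + ‖w‖)) ^ 3 * (C₃ * (3 * (1 + ‖w‖)) ^ A)) := by gcongr
    _ = _ := by simp only [mul_pow]; ring

/-- The integrand of `R(g; X)`, in the variable `w = 2πiτ / log X` and multiplied by `w`. -/
noncomputable def ratiosNumerator (g : 𝓢(ℝ, ℂ)) (X : ℝ) (d : ℤ) (w : ℂ) : ℂ :=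
  fourierLaplace (𝓕 g : 𝓢(ℝ, ℂ)) (-(Complex.I * w * (Real.log X / (2 * Real.pi) : ℝ))) *
    Complex.exp (-(w * (Real.log (d / Real.pi) : ℝ))) * ratiosKernel w

/-- The factor `1/4 - w/2` that turns `Γ(1/4 - w/2)` into `Γ(5/4 - w/2)` is a quarter of the factor
`1 - 2w` that turns `ζ(2 - 2w)` into `zetaReg (2 - 2w)`. Their quotient is constant, which is the
cancellation at `w = 1/2`. -/
theorem ratiosIntegrand_eq (g : 𝓢(ℝ, ℂ)) {X : ℝ} (hX : 1 < X) (d : ℤ) {τ : ℝ} (hτ : τ ≠ 0) :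
    ratiosIntegrand g X d τ =
      ratiosNumerator g X d ((2 * Real.pi / Real.log X * τ : ℝ) * Complex.I) /
        ((2 * Real.pi / Real.log X * τ : ℝ) * Complex.I) := by
  have hL : 0 < Real.log X := Real.log_pos hX
  have hpi := Real.pi_pos
  set t : ℝ := 2 * Real.pi / Real.log X * τ
  have ht : t ≠ 0 := by positivity
  have htL : t * (Real.log X / (2 * Real.pi)) = τ := by simp only [t]; field_simp
  have htL' : 2 * Real.pi * τ / Real.log X = t := by simp only [t]; ring
  set w : ℂ := (t : ℂ) * Complex.I
  have hw : w ≠ 0 := mul_ne_zero (by exact_mod_cast ht) Complex.I_ne_zero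
  have hwre : w.re = 0 := by simp [w]
  have e1 : 2 * Real.pi * Complex.I * τ / Real.log X = w := by
    simp only [w]; rw [← htL']; push_cast; ring
  have e2 : Real.pi * Complex.I * τ / Real.log X = w / 2 := by rw [← e1]; ring
  have e3 : 4 * Real.pi * Complex.I * τ / Real.log X = 2 * w := by rw [← e1]; ring
  have e4 : -2 * Real.pi * Complex.I * τ * (Real.log (d / Real.pi) / Real.log X : ℝ) =
      -(w * (Real.log (d / Real.pi) : ℝ)) := by rw [← e1]; push_cast; ring
  have e5 : -(Complex.I * w * (Real.log X / (2 * Real.pi) : ℝ)) = (τ : ℂ) := by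
    simp only [w]
    rw [← htL]
    push_cast
    linear_combination (-(t : ℂ) * (Real.log X / (2 * Real.pi))) * Complex.I_sq
  rw [ratiosIntegrand, ratiosNumerator, e1, e2, e3, e4, e5, fourierLaplace_fourier,
    arithFactor_eq (by rw [hwre]; norm_num), ratiosKernel]
  have hne : ∀ a : ℂ, a.re ≠ 0 → a ≠ 0 := fun a ha h => ha (by simp [h])
  have hg1 : (1 / 4 - w / 2 : ℂ) ≠ 0 := hne _ (by simp [hwre])
  have hG : Complex.Gamma (5 / 4 - w / 2) = (1 / 4 - w / 2) * Complex.Gamma (1 / 4 - w / 2) := by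
    rw [← Complex.Gamma_add_one _ hg1]; congr 1; ring
  have hz1 : zetaReg (1 - 2 * w) = -2 * w * riemannZeta (1 - 2 * w) := by
    rw [zetaReg_of_ne (fun h => hw (by linear_combination -(1 / 2) * h))]; ring
  have hz2 : zetaReg (2 - 2 * w) = 4 * (1 / 4 - w / 2) * riemannZeta (2 - 2 * w) := by
    rw [zetaReg_of_ne (fun h => hg1 (by linear_combination (1 / 4) * h))]; ring
  have hζ : riemannZeta (2 - 2 * w) ≠ 0 :=
    riemannZeta_ne_zero_of_one_lt_re (by simp [hwre])
  have hG2 : Complex.Gamma (1 / 4 + w / 2) ≠ 0 :=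
    Complex.Gamma_ne_zero_of_re_pos (by simp [hwre])
  rw [hG, hz1, hz2]
  generalize (1 / 4 - w / 2 : ℂ) = u at *
  field_simp
  norm_num

section

variable {g : 𝓢(ℝ, ℂ)} {σ : ℝ}

theorem ratiosNumerator_zero (X : ℝ) (d : ℤ) : ratiosNumerator g X d 0 = -(g 0) / 2 := by
  have : fourierLaplace (𝓕 g : 𝓢(ℝ, ℂ)) 0 = g 0 := by
    simpa using fourierLaplace_fourier g 0
  simp [ratiosNumerator, this, ratiosKernel_zero]
  ring

theorem differentiableOn_ratiosNumerator (hRH : RiemannHypothesis)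
    (hsupp : tsupport (𝓕 g : 𝓢(ℝ, ℂ)) ⊆ Set.Ioo (-σ) σ) (X : ℝ) (d : ℤ) :
    DifferentiableOn ℂ (ratiosNumerator g X d) {w : ℂ | -1 / 2 < w.re ∧ w.re < 3 / 4} := by
  refine DifferentiableOn.mul (Differentiable.differentiableOn ?_)
    (differentiableOn_ratiosKernel hRH)
  refine Differentiable.mul ?_ (by fun_prop)
  exact (differentiable_fourierLaplace hsupp).comp (by fun_prop)

theorem exists_norm_ratiosNumerator_le (hRH : RiemannHypothesis)
    (hsupp : tsupport (𝓕 g : 𝓢(ℝ, ℂ)) ⊆ Set.Ioo (-σ) σ) {c : ℝ} (hc : c < 3 / 4) :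
    ∃ (C : ℝ) (N : ℕ), 0 ≤ C ∧ ∀ X : ℝ, 1 < X → ∀ (d : ℤ) (w : ℂ), 0 ≤ w.re → w.re ≤ c →
      ‖ratiosNumerator g X d w‖ ≤ C * max 1 (2 * Real.pi / Real.log X) ^ N *
        Real.exp (σ * w.re * Real.log X) * Real.exp (-(w.re * Real.log (d / Real.pi))) /
          (1 + ‖w‖) ^ 2 := by
  obtain ⟨C₁, A, h₁, hC₁⟩ := exists_norm_ratiosKernel_le hRH hc
  -- `A` powers absorb the growth of the kernel; the other two give integrable decay.
  obtain ⟨C₂, h₂, hC₂⟩ := exists_norm_fourierLaplace_le (A + 2) _ hsupp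
  refine ⟨C₁ * C₂, A + 2, by positivity, fun X hX d w hw0 hwc => ?_⟩
  have hL : 0 < Real.log X := Real.log_pos hX
  have hpi := Real.pi_pos
  set z : ℂ := -(Complex.I * w * (Real.log X / (2 * Real.pi) : ℝ))
  set m : ℝ := max 1 (2 * Real.pi / Real.log X)
  have hm : 0 < m := lt_of_lt_of_le one_pos (le_max_left _ _)
  have hzn : ‖z‖ = ‖w‖ * (Real.log X / (2 * Real.pi)) := by
    simp only [z, norm_neg, norm_mul, Complex.norm_I, one_mul, Complex.norm_real]
    rw [Real.norm_of_nonneg (by positivity)]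
  have hzim : |z.im| = w.re * (Real.log X / (2 * Real.pi)) := by
    have : z.im = -(w.re * (Real.log X / (2 * Real.pi))) := by
      simp only [z, Complex.neg_im, Complex.im_mul_ofReal, Complex.I_mul_im]
    rw [this, abs_neg, abs_of_nonneg (by positivity)]
  have hwm : 1 + ‖w‖ ≤ m * (1 + ‖z‖) := by
    have h1 : ‖w‖ = 2 * Real.pi / Real.log X * ‖z‖ := by rw [hzn]; field_simp
    have h2 : 2 * Real.pi / Real.log X * ‖z‖ ≤ m * ‖z‖ := by
      gcongr; exact le_max_right _ _
    have h3 : 1 ≤ m := le_max_left _ _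
    linarith
  have hexp : 2 * Real.pi * σ * |z.im| = σ * w.re * Real.log X := by rw [hzim]; field_simp
  have hF := hC₂ z
  rw [hexp] at hF
  have hE : ‖Complex.exp (-(w * (Real.log (d / Real.pi) : ℝ)))‖ =
      Real.exp (-(w.re * Real.log (d / Real.pi))) := by
    rw [Complex.norm_exp]; simp
  have hFw : (1 + ‖w‖) ^ (A + 2) * ‖fourierLaplace (𝓕 g : 𝓢(ℝ, ℂ)) z‖ ≤
      m ^ (A + 2) * (C₂ * Real.exp (σ * w.re * Real.log X)) := by
    calc _ ≤ (m * (1 + ‖z‖)) ^ (A + 2) * ‖fourierLaplace (𝓕 g : 𝓢(ℝ, ℂ)) z‖ := by gcongr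
      _ = m ^ (A + 2) * ((1 + ‖z‖) ^ (A + 2) * ‖fourierLaplace (𝓕 g : 𝓢(ℝ, ℂ)) z‖) := by
        rw [mul_pow]; ring
      _ ≤ _ := by gcongr
  rw [ratiosNumerator, norm_mul, norm_mul, hE, le_div_iff₀ (by positivity)]
  calc ‖fourierLaplace (𝓕 g : 𝓢(ℝ, ℂ)) z‖ * Real.exp (-(w.re * Real.log (d / Real.pi))) *
        ‖ratiosKernel w‖ * (1 + ‖w‖) ^ 2
      ≤ ‖fourierLaplace (𝓕 g : 𝓢(ℝ, ℂ)) z‖ * Real.exp (-(w.re * Real.log (d / Real.pi))) *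
        (C₁ * (1 + ‖w‖) ^ A) * (1 + ‖w‖) ^ 2 := by
        have := hC₁ w hw0 hwc
        gcongr
    _ = C₁ * Real.exp (-(w.re * Real.log (d / Real.pi))) *
        ((1 + ‖w‖) ^ (A + 2) * ‖fourierLaplace (𝓕 g : 𝓢(ℝ, ℂ)) z‖) := by ring
    _ ≤ C₁ * Real.exp (-(w.re * Real.log (d / Real.pi))) *
        (m ^ (A + 2) * (C₂ * Real.exp (σ * w.re * Real.log X))) := by gcongr
    _ = _ := by ring

theorem exists_hasPrincipalValue_ratiosIntegrand (hRH : RiemannHypothesis)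
    (hsupp : tsupport (𝓕 g : 𝓢(ℝ, ℂ)) ⊆ Set.Ioo (-σ) σ) {c : ℝ} (hc0 : 0 < c) (hc : c < 3 / 4) :
    ∃ (C : ℝ) (N : ℕ), 0 ≤ C ∧ ∀ X : ℝ, 1 < X → ∀ d : ℤ, ∃ S : ℂ,
      HasPrincipalValue (ratiosIntegrand g X d)
        ((Real.log X / (2 * Real.pi) : ℝ) * (S + Real.pi * (g 0) / 2)) ∧
      ‖S‖ ≤ C * max 1 (2 * Real.pi / Real.log X) ^ N *
        Real.exp (σ * c * Real.log X) * Real.exp (-(c * Real.log (d / Real.pi))) := by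
  obtain ⟨C, N, hC0, hC⟩ := exists_norm_ratiosNumerator_le hRH hsupp hc
  refine ⟨C * (c⁻¹ * Real.pi), N, by positivity, fun X hX d => ?_⟩
  have hL : 0 < Real.log X := Real.log_pos hX
  have hpi := Real.pi_pos
  set m : ℝ := max 1 (2 * Real.pi / Real.log X)
  have hm : 0 < m := lt_of_lt_of_le one_pos (le_max_left _ _)
  set E := ratiosNumerator g X d
  refine ⟨∫ t : ℝ, E (c + t * Complex.I) / (c + t * Complex.I), ?_, ?_⟩
  · have h := hasPrincipalValue_of_strip (E := E) (c := c)
      (C := C * m ^ N * Real.exp (|σ| * c * Real.log X) *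
        Real.exp (c * |Real.log (d / Real.pi)|)) hc0
      (isOpen_re_strip (-1 / 2) (3 / 4)) (fun w h1 h2 => ⟨by linarith, by linarith⟩)
      (differentiableOn_ratiosNumerator hRH hsupp X d) (fun w h1 h2 => by
        refine (hC X hX d w h1 h2).trans ?_
        have i1 : σ * w.re ≤ |σ| * c := by
          have := le_abs_self σ
          have := abs_nonneg σ
          nlinarith
        have i2 : -(w.re * Real.log (d / Real.pi)) ≤ c * |Real.log (d / Real.pi)| := by
          have := neg_abs_le (Real.log (d / Real.pi))
          have := abs_nonneg (Real.log (d / Real.pi))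
          nlinarith
        gcongr)
    have h2 := (h.comp_mul_left (a := 2 * Real.pi / Real.log X) (by positivity)).congr
      (g := ratiosIntegrand g X d) fun τ hτ => ratiosIntegrand_eq g hX d hτ
    rw [show E 0 = -(g 0) / 2 from ratiosNumerator_zero X d] at h2
    convert h2 using 1
    push_cast
    rw [inv_div]
    ring
  · have hb : ∀ t : ℝ, ‖E (c + t * Complex.I) / (c + t * Complex.I)‖ ≤
        C * m ^ N * Real.exp (σ * c * Real.log X) *
          Real.exp (-(c * Real.log (d / Real.pi))) * c⁻¹ * (1 + t ^ 2)⁻¹ := by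
      intro t
      have hre : ((c : ℂ) + t * Complex.I).re = c := by simp
      have h1 := hC X hX d (c + t * Complex.I) (by rw [hre]; exact hc0.le) hre.le
      rw [hre] at h1
      have h2 : c ≤ ‖(c : ℂ) + t * Complex.I‖ := by
        simpa using Complex.re_le_norm ((c : ℂ) + t * Complex.I)
      have h3 : |t| ≤ ‖(c : ℂ) + t * Complex.I‖ := by
        simpa using Complex.abs_im_le_norm ((c : ℂ) + t * Complex.I)
      have h4 : 1 + t ^ 2 ≤ (1 + ‖(c : ℂ) + t * Complex.I‖) ^ 2 := by
        rw [← sq_abs]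
        have := abs_nonneg t
        nlinarith
      rw [norm_div, div_eq_mul_inv]
      calc _ ≤ C * m ^ N * Real.exp (σ * c * Real.log X) *
            Real.exp (-(c * Real.log (d / Real.pi))) / (1 + t ^ 2) * c⁻¹ := by
            refine mul_le_mul (h1.trans ?_) (by gcongr) (by positivity) (by positivity)
            gcongr
        _ = _ := by ring
    refine (norm_integral_le_of_norm_le (integrable_inv_one_add_sq.const_mul _)
      (Eventually.of_forall hb)).trans (le_of_eq ?_)
    rw [integral_const_mul, integral_univ_inv_one_add_sq]
    ring

/-! ### Averaging over discriminants and the conclusion. -/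

theorem ratiosTerm_isBigO (hRH : RiemannHypothesis)
    (hsupp : tsupport (𝓕 g : 𝓢(ℝ, ℂ)) ⊆ Set.Ioo (-σ) σ) {c : ℝ} (hc0 : 0 < c) (hc : c < 3 / 4) :
    (fun X : ℝ => ratiosTerm g X - (-(g 0) / 2)) =O[atTop] fun X : ℝ => X ^ (-c * (1 - σ)) := by
  obtain ⟨C, N, hC0, hC⟩ := exists_hasPrincipalValue_ratiosIntegrand hRH hsupp hc0 hc
  have hpi := Real.pi_pos
  refine Asymptotics.IsBigO.of_bound (Real.pi⁻¹ * C * Real.pi ^ c * (32 / (1 - c))) ?_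
  -- `300` is the threshold of the lower bound for `X*`; beyond `e ^ (2π)` the maximum in the bound
  -- for `S` equals `1`.
  filter_upwards [eventually_ge_atTop 300, eventually_ge_atTop (Real.exp (2 * Real.pi))]
    with X hX300 hXe
  have hX1 : 1 < X := by linarith
  have hX0 : 0 < X := by linarith
  have hL : 0 < Real.log X := Real.log_pos hX1
  have hL2 : 2 * Real.pi ≤ Real.log X := (Real.le_log_iff_exp_le hX0).2 hXe
  have hm : max 1 (2 * Real.pi / Real.log X) = 1 := max_eq_left ((div_le_one hL).2 hL2)
  choose S hS hSn using hC X hX1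
  have hcard := le_card_evenFundDiscr hX300
  have hn0 : (0 : ℝ) < (evenFundDiscr X).card := by linarith
  have hn0' : ((evenFundDiscr X).card : ℂ) ≠ 0 := by
    have := hn0.ne'
    exact_mod_cast this
  have hLc : (Real.log X : ℂ) ≠ 0 := by exact_mod_cast hL.ne'
  have hpic : (Real.pi : ℂ) ≠ 0 := by exact_mod_cast hpi.ne'
  have hterm : ratiosTerm g X - (-(g 0) / 2) =
      -((Real.pi : ℂ)⁻¹ * ((evenFundDiscr X).card : ℂ)⁻¹ * ∑ d ∈ evenFundDiscr X, S d) := by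
    have hpv : ∀ d ∈ evenFundDiscr X, principalValue (ratiosIntegrand g X d) =
        (Real.log X / (2 * Real.pi) : ℝ) * (S d + Real.pi * (g 0) / 2) :=
      fun d _ => (hS d).principalValue_eq
    rw [ratiosTerm, Finset.sum_congr rfl hpv, ← Finset.mul_sum, Finset.sum_add_distrib,
      Finset.sum_const, nsmul_eq_mul]
    push_cast
    field_simp
    ring
  have hSd : ∀ d ∈ evenFundDiscr X, ‖S d‖ ≤ C * X ^ (σ * c) * Real.pi ^ c * (d : ℝ) ^ (-c) := by
    intro d hd
    simp only [evenFundDiscr, Finset.mem_filter, Finset.mem_Ioc] at hd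
    have hd0 : (0 : ℝ) < d := by exact_mod_cast hd.1.1
    have h := hSn d
    rw [hm, one_pow, mul_one] at h
    refine h.trans (le_of_eq ?_)
    have hsplit : Real.exp (-(c * Real.log (d / Real.pi))) =
        Real.exp (Real.log Real.pi * c) * Real.exp (Real.log d * -c) := by
      rw [← Real.exp_add, Real.log_div hd0.ne' hpi.ne']
      congr 1
      ring
    rw [hsplit, Real.rpow_def_of_pos hX0, Real.rpow_def_of_pos hpi, Real.rpow_def_of_pos hd0,
      mul_comm (σ * c)]
    ring
  have hc1 : 0 < 1 - c := by linarith
  have hsum : ‖∑ d ∈ evenFundDiscr X, S d‖ ≤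
      C * X ^ (σ * c) * Real.pi ^ c * (X ^ (1 - c) / (1 - c)) := by
    refine (norm_sum_le_of_le _ hSd).trans ?_
    rw [← Finset.mul_sum]
    have := sum_evenFundDiscr_rpow_neg_le hc0.le (by linarith : c < 1) hX0.le
    gcongr
  have hinv : ((evenFundDiscr X).card : ℝ)⁻¹ ≤ 32 * X⁻¹ := by
    have := inv_anti₀ (by positivity) hcard
    rwa [inv_div, div_eq_mul_inv] at this
  rw [hterm, norm_neg, norm_mul, norm_mul, norm_inv, norm_inv, Complex.norm_real,
    Complex.norm_natCast, Real.norm_of_nonneg hpi.le, Real.norm_of_nonneg (by positivity)]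
  calc Real.pi⁻¹ * ((evenFundDiscr X).card : ℝ)⁻¹ * ‖∑ d ∈ evenFundDiscr X, S d‖
      ≤ Real.pi⁻¹ * (32 * X⁻¹) * (C * X ^ (σ * c) * Real.pi ^ c * (X ^ (1 - c) / (1 - c))) := by
        gcongr
    _ = Real.pi⁻¹ * C * Real.pi ^ c * (32 / (1 - c)) * (X⁻¹ * X ^ (σ * c) * X ^ (1 - c)) := by
        ring
    _ = _ := by
        rw [← Real.rpow_neg_one X, ← Real.rpow_add hX0, ← Real.rpow_add hX0]
        congr 2
        ring

end

theorem rpow_isBigO_rpow_atTop {a b : ℝ} (h : a ≤ b) :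
    (fun X : ℝ => X ^ a) =O[atTop] fun X : ℝ => X ^ b := by
  refine Asymptotics.IsBigO.of_bound 1 ?_
  filter_upwards [eventually_ge_atTop 1] with X hX
  rw [one_mul, Real.norm_of_nonneg (by positivity), Real.norm_of_nonneg (by positivity)]
  exact Real.rpow_le_rpow_of_exponent_le hX h

theorem mainTheorem3 (hRH : RiemannHypothesis) (g : 𝓢(ℝ, ℂ)) (hg : ∀ x : ℝ, g (-x) = g x)
    (σ : ℝ) (hsupp : tsupport (𝓕 g : 𝓢(ℝ, ℂ)) ⊆ Set.Ioo (-σ) σ) :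
    (∀ X : ℝ, 1 < X → ∀ d ∈ evenFundDiscr X, ∃ I : ℂ,
      HasPrincipalValue (ratiosIntegrand g X d) I) ∧
    (∀ ε : ℝ, 0 < ε →
      (fun X : ℝ => ratiosTerm g X - (-(g 0) / 2)) =O[atTop]
        fun X : ℝ => X ^ (-(3 / 4) * (1 - σ) + ε)) ∧
    (σ < 1 / 3 → ∀ ε : ℝ, 0 < ε →
      (fun X : ℝ => ratiosTerm g X - (-(g 0) / 2)) =O[atTop]
        fun X : ℝ => X ^ (-(1 / 2) + ε)) := by
  have key : ∀ ε : ℝ, 0 < ε →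
      (fun X : ℝ => ratiosTerm g X - (-(g 0) / 2)) =O[atTop]
        fun X : ℝ => X ^ (-(3 / 4) * (1 - σ) + ε) := by
    intro ε hε
    -- With `c = 3/4 - η` the exponent exceeds `-(3/4)(1 - σ)` by `η (1 - σ) ≤ ε`, whatever the sign
    -- of `1 - σ`; `η ≤ 1/2` keeps `c` positive.
    set η : ℝ := min (1 / 2) (ε / (1 + |1 - σ|))
    have hη0 : 0 < η := lt_min (by norm_num) (by positivity)
    have hη1 : η ≤ 1 / 2 := min_le_left _ _
    have hη2 : η * (1 + |1 - σ|) ≤ ε :=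
      (le_div_iff₀ (by positivity)).1 (min_le_right (1 / 2) (ε / (1 + |1 - σ|)))
    refine (ratiosTerm_isBigO hRH hsupp (c := 3 / 4 - η) (by linarith) (by linarith)).trans
      (rpow_isBigO_rpow_atTop ?_)
    have := le_abs_self (1 - σ)
    nlinarith
  refine ⟨fun X hX d _ => ?_, key, fun hσ ε hε => (key ε hε).trans (rpow_isBigO_rpow_atTop ?_)⟩
  · obtain ⟨C, N, -, hC⟩ := exists_hasPrincipalValue_ratiosIntegrand hRH hsupp (c := 1 / 2)
      (by norm_num) (by norm_num)
    obtain ⟨S, hS, -⟩ := hC X hX d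
    exact ⟨_, hS⟩
  · linarith
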